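/- Let $q$ be a prime power, let $n\ge 0$, let $G=\mathrm{GL}_n(\mathbb F_q)$, and fix a nontrivial homomorphism $\vartheta:\mathbb F_q^+\to\mathbb C^\times$. For a partition $\lambda=(\lambda_1\ge\lambda_2\ge\cdots)$ of $n$, with conjugate $\lambda'$, the generalized Gelfand--Graev character $\Gamma_\lambda$ of $G$ is defined as follows. Let $m=\lambda_1$ and let $\mathrm{ctr}$ be the permutation of $\{1,\dots,m\}$ with $\mathrm{ctr}(j)=\lfloor m/2\rfloor+1+\frac{j-1}{2}$ for $j$ odd and $\mathrm{ctr}(j)=\lfloor m/2\rfloor+1-\frac j2$ for $j$ even. Let $\mathrm{ctr}(\lambda')$ be the composition of $n$ whose part number $\mathrm{ctr}(j)$ is $\lambda'_j$ for $1\le j\le m$. For a composition $\alpha=(\alpha_1,\dots,\alpha_\ell)$ of $n$, let $U_\alpha\subseteq G$ be the group of block upper triangular matrices with diagonal blocks $\mathrm{Id}_{\alpha_1},\dots,\mathrm{Id}_{\alpha_\ell}$. Center the rows of the Ferrers diagram of $\lambda$, and number its boxes $1,\dots,n$ down the consecutive half-columns, taken from left to right: the $j$-th box of the $i$-th row has horizontal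 position $2j+(\lambda_1-\lambda_i)$, and the boxes are numbered by increasing horizontal position and, within the same position, from the top row to the bottom row. Let $\mathrm{ggg}(\lambda)$ be the set of pairs $(a,b)$ such that $a$ and $b$ are the numbers of the $j$-th and the $(j+1)$-st box of one and the same row, for some $j$. Then $$\gamma_\lambda(u)=\prod_{(a,b)\in\mathrm{ggg}(\lambda)}\vartheta(u_{ab})$$ defines a homomorphism $\gamma_\lambda:U_{\mathrm{ctr}(\lambda')}\to\mathbb C^\times$, and $\Gamma_\lambda$ is the character of $\mathrm{Ind}_{U_{\mathrm{ctr}(\lambda')}}^{G}(\gamma_\lambda)$. A unipotent element of $G$ has Jordan type $\mu$ if the sizes of its Jordan blocks are the parts of $\mu$, and $\mu\preceq\lambda$ denotes the dominance order: $\mu_1+\cdots+\mu_k\le\lambda_1+\cdots+\lambda_k$ for all $k$. Let $\lambda$ and $\mu$ be partitions of $n$. Then: (a) If $u\in G$ is unipotent of Jordan type $\mu$, then $\Gamma_\lambda(u)=0$ unless $\mu\preceq\lambda$. (b) If $u_\lambda\in G$ is unipotent of Jordan type $\lambda$, then $\Gamma_\lambda(u_\lambda)\ne 0$. -/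

import Mathlib

/-!
Partitions are Young diagrams: the box `(i, j)` is in row `i` and column `j`, counted from `0`;
`lam.rowLen i` is the part `i + 1` of the partition, and `lam.card` is its size.
-/

namespace GGG

open Finset

/-! ### Unipotent radicals of the standard parabolic subgroups -/

/-- The block (counted from `0`) of the index `a` (counted from `0`) when the indices are cut into
consecutive blocks whose sizes are the entries of `α`. -/
def blockIndex (α : List ℕ) (a : ℕ) : ℕ :=
  #{k ∈ range α.length | (α.take (k + 1)).sum ≤ a}

lemma val_eq_one_add {n : ℕ} {F : Type*} [Field F] (u : GL (Fin n) F) :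
    u.val = 1 + (u.val - 1) := by abel

/-- The group `U_α` of the block upper triangular matrices with identity blocks, of sizes `α`, on
the diagonal: a nonzero entry of `u - 1` lies in a block column strictly to the right of the block
with its row index. -/
def unipotentRadical (n : ℕ) (F : Type*) [Field F] (α : List ℕ) : Subgroup (GL (Fin n) F) where
  carrier := {u | ∀ a b : Fin n, (u.val - 1) a b ≠ 0 → blockIndex α a < blockIndex α b}
  one_mem' := by intro a b h; simp at h
  mul_mem' := by
    intro u v hu hv a b h
    by_contra hlt
    apply h
    have hu' : ∀ a b : Fin n, ¬ blockIndex α a < blockIndex α b → (u.val - 1) a b = 0 :=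
      fun a b h => by_contra fun h' => h (hu a b h')
    have hv' : ∀ a b : Fin n, ¬ blockIndex α a < blockIndex α b → (v.val - 1) a b = 0 :=
      fun a b h => by_contra fun h' => h (hv a b h')
    have e : (u * v).val - 1 = (u.val - 1) + (v.val - 1) + (u.val - 1) * (v.val - 1) := by
      rw [Units.val_mul]; noncomm_ring
    rw [e, Matrix.add_apply, Matrix.add_apply, hu' a b hlt, hv' a b hlt, Matrix.mul_apply]
    simp only [zero_add]
    refine Finset.sum_eq_zero fun k _ => ?_
    by_cases h1 : blockIndex α a < blockIndex α k
    · rw [hv' k b (by omega), mul_zero]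
    · rw [hu' a k h1, zero_mul]
  inv_mem' := by
    intro u hu a b h
    by_contra hlt
    apply h
    have hu' : ∀ a b : Fin n, ¬ blockIndex α a < blockIndex α b → (u.val - 1) a b = 0 :=
      fun a b h => by_contra fun h' => h (hu a b h')
    have hbt : Matrix.BlockTriangular u.val (fun a : Fin n => blockIndex α a) := by
      intro i j hij
      have h0 := hu' i j (by simpa using hij.le)
      have hne : i ≠ j := by rintro rfl; exact lt_irrefl _ hij
      simpa [Matrix.sub_apply, Matrix.one_apply_ne hne] using h0
    have : Invertible u.val := u.invertible
    have hinv : Matrix.BlockTriangular (u⁻¹).val (fun a : Fin n => blockIndex α a) := by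
      have := Matrix.blockTriangular_inv_of_blockTriangular hbt
      rwa [← Matrix.coe_units_inv] at this
    have e : (u⁻¹).val - 1 = - ((u⁻¹).val * (u.val - 1)) := by
      rw [mul_sub, mul_one, Units.inv_mul]; abel
    rw [e, Matrix.neg_apply, Matrix.mul_apply, neg_eq_zero]
    refine Finset.sum_eq_zero fun k _ => ?_
    by_cases h1 : blockIndex α k < blockIndex α a
    · rw [hinv h1, zero_mul]
    · rw [hu' k b (by omega), mul_zero]

/-! ### The combinatorial data attached to a partition -/

/-- The permutation of the columns `1, …, m` that moves the odd columns, in their order, to the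
end and the even columns, in the reversed order, to the beginning. -/
def ctr (m j : ℕ) : ℕ :=
  if Odd j then m / 2 + 1 + (j - 1) / 2 else m / 2 + 1 - j / 2

/-- The composition `ctr(lam')`: its entries are the lengths of the columns `1, …, lam₁` of the
shape obtained from the Ferrers shape of `lam` by moving each column `j` to position `ctr(j)`. -/
def ctrComposition (lam : YoungDiagram) : List ℕ :=
  (List.range (lam.rowLen 0)).map fun k =>
    #{c ∈ lam.cells | ctr (lam.rowLen 0) (c.2 + 1) = k + 1}

/-- The horizontal position, in units of half a box, of a box after the rows are centered. -/
def halfColumn (lam : YoungDiagram) (c : ℕ × ℕ) : ℕ :=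
  2 * c.2 + (lam.rowLen 0 - lam.rowLen c.1)

/-- The entry, counted from `0`, of the box `c` in the column reading tableau `C_lam`: the boxes
of the row-centered shape are numbered down the consecutive half-columns, from left to right. -/
def entry (lam : YoungDiagram) (c : ℕ × ℕ) : ℕ :=
  #{d ∈ lam.cells | halfColumn lam d < halfColumn lam c ∨
    (halfColumn lam d = halfColumn lam c ∧ d.1 < c.1)}

/-- The arcs of the set partition `ggg(lam)`: pairs of entries of `C_lam` in the same row and in
consecutive columns, that is, of horizontally adjacent boxes. -/
def ggg (lam : YoungDiagram) : Finset (Fin lam.card × Fin lam.card) :=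
  {p | ∃ c ∈ lam.cells, (c.1, c.2 + 1) ∈ lam.cells ∧
    p.1.val = entry lam c ∧ p.2.val = entry lam (c.1, c.2 + 1)}

/-! ### Compatibility of the tableau with the composition -/

/-- The column, counted from `0`, of a box in the shape with permuted columns. -/
def shiftedColumn (lam : YoungDiagram) (c : ℕ × ℕ) : ℕ :=
  c.2 + lam.rowLen 0 / 2 - lam.rowLen c.1 / 2

lemma card_ctr_le (m k l : ℕ) (hl : l ≤ m) :
    #{j ∈ range l | ctr m (j + 1) ≤ k + 1} = min l (k + 1 - (m / 2 - l / 2)) := by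
  induction l with
  | zero => simp
  | succ l ih =>
    rw [range_add_one, filter_insert]
    have ih := ih (by omega)
    rcases Nat.even_or_odd l with he | ho
    · have h1 : ctr m (l + 1) = m / 2 + 1 + l / 2 := by
        rw [ctr, if_pos he.add_one]; simp
      obtain ⟨t, ht⟩ := he
      split_ifs with h
      · rw [card_insert_of_notMem (by simp), ih]; omega
      · rw [ih]; omega
    · have h1 : ctr m (l + 1) = m / 2 + 1 - (l + 1) / 2 := by
        rw [ctr, if_neg (by simpa using ho.add_one)]
      obtain ⟨t, ht⟩ := ho
      split_ifs with h
      · rw [card_insert_of_notMem (by simp), ih]; omega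
      · rw [ih]; omega

lemma card_shift_le (m k l : ℕ) (hl : l ≤ m) :
    #{j ∈ range l | j + m / 2 - l / 2 ≤ k} = min l (k + 1 - (m / 2 - l / 2)) := by
  have : {j ∈ range l | j + m / 2 - l / 2 ≤ k} = range (min l (k + 1 - (m / 2 - l / 2))) := by
    ext j; simp only [mem_filter, mem_range]; omega
  rw [this, card_range]

lemma card_filter_cells (lam : YoungDiagram) (p : ℕ → ℕ → Prop) [∀ i j, Decidable (p i j)] :
    #{c ∈ lam.cells | p c.1 c.2} =
      ∑ i ∈ range (lam.colLen 0), #{j ∈ range (lam.rowLen i) | p i j} := by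
  rw [card_eq_sum_card_fiberwise (f := Prod.fst) (t := range (lam.colLen 0))]
  · refine sum_congr rfl fun i _ => ?_
    refine card_bij' (fun c _ => c.2) (fun j _ => (i, j)) ?_ ?_ ?_ ?_
    · rintro ⟨a, b⟩ h
      simp only [mem_filter, YoungDiagram.mem_cells, YoungDiagram.mem_iff_lt_rowLen] at h
      obtain ⟨⟨h1, h2⟩, rfl⟩ := h
      simp [h1, h2]
    · intro j h
      simp only [mem_filter, mem_range] at h
      simp [YoungDiagram.mem_iff_lt_rowLen, h.1, h.2]
    · rintro ⟨a, b⟩ h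
      simp only [mem_filter] at h
      simp [h.2]
    · intro j h; rfl
  · rintro ⟨a, b⟩ h
    simp only [coe_filter, YoungDiagram.mem_cells, Set.mem_ofPred_eq] at h
    simp only [coe_range, Set.mem_Iio]
    exact YoungDiagram.mem_iff_lt_colLen.1 (lam.up_left_mem le_rfl (Nat.zero_le b) h.1)

lemma take_sum (lam : YoungDiagram) (k : ℕ) (hk : k < lam.rowLen 0) :
    ((ctrComposition lam).take (k + 1)).sum = #{d ∈ lam.cells | shiftedColumn lam d ≤ k} := by
  have h0 : ∀ k, k ≤ lam.rowLen 0 → ((ctrComposition lam).take k).sum =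
      #{d ∈ lam.cells | ctr (lam.rowLen 0) (d.2 + 1) ≤ k} := by
    intro k hk
    induction k with
    | zero =>
      symm
      rw [List.take_zero, List.sum_nil, card_eq_zero, filter_eq_empty_iff]
      rintro ⟨i, j⟩ h
      have h1 := YoungDiagram.mem_iff_lt_rowLen.1 ((YoungDiagram.mem_cells _).1 h)
      have h2 := lam.rowLen_anti 0 i (Nat.zero_le i)
      simp only [ctr]
      split_ifs <;> omega
    | succ k ih =>
      have hlen : k < (ctrComposition lam).length := by simp [ctrComposition]; omega
      rw [List.take_succ_eq_append_getElem hlen, List.sum_append, ih (by omega)]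
      simp only [ctrComposition, List.getElem_map, List.getElem_range, List.sum_singleton]
      rw [← card_union_of_disjoint]
      · congr 1
        ext d
        simp only [mem_union, mem_filter]
        constructor
        · rintro (h | h)
          · exact ⟨h.1, by omega⟩
          · exact ⟨h.1, by omega⟩
        · rintro ⟨h1, h2⟩
          by_cases h3 : ctr (lam.rowLen 0) (d.2 + 1) ≤ k
          · exact Or.inl ⟨h1, h3⟩
          · exact Or.inr ⟨h1, by omega⟩
      · rw [disjoint_filter]
        intro d _ h1 h2
        omega
  rw [h0 _ (by omega), card_filter_cells lam fun _ j => ctr (lam.rowLen 0) (j + 1) ≤ k + 1]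
  refine Eq.trans ?_
    (card_filter_cells lam fun i j => j + lam.rowLen 0 / 2 - lam.rowLen i / 2 ≤ k).symm
  refine sum_congr rfl fun i _ => ?_
  have h2 := lam.rowLen_anti 0 i (Nat.zero_le i)
  rw [card_ctr_le _ _ _ h2, card_shift_le _ _ _ h2]

lemma shiftedColumn_eq (lam : YoungDiagram) {c : ℕ × ℕ} (hc : c ∈ lam.cells) :
    shiftedColumn lam c = (halfColumn lam c + (lam.rowLen 0 + 1) % 2) / 2 := by
  have h1 := YoungDiagram.mem_iff_lt_rowLen.1 ((YoungDiagram.mem_cells _).1 hc)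
  have h2 := lam.rowLen_anti 0 c.1 (Nat.zero_le c.1)
  simp only [shiftedColumn, halfColumn]
  omega

/-- The entries of a column of the shape with permuted columns are exactly those of the
corresponding block of `ctr(lam')`. -/
lemma blockIndex_entry (lam : YoungDiagram) {c : ℕ × ℕ} (hc : c ∈ lam.cells) :
    blockIndex (ctrComposition lam) (entry lam c) = shiftedColumn lam c := by
  have h1 := YoungDiagram.mem_iff_lt_rowLen.1 ((YoungDiagram.mem_cells _).1 hc)
  have h2 := lam.rowLen_anti 0 c.1 (Nat.zero_le c.1)
  have hlen : (ctrComposition lam).length = lam.rowLen 0 := by simp [ctrComposition]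
  have hcol : shiftedColumn lam c < lam.rowLen 0 := by simp only [shiftedColumn]; omega
  rw [blockIndex, hlen]
  have : {k ∈ range (lam.rowLen 0) | ((ctrComposition lam).take (k + 1)).sum ≤ entry lam c} =
      range (shiftedColumn lam c) := by
    ext k
    simp only [mem_filter, mem_range]
    constructor
    · rintro ⟨hk, h⟩
      by_contra hlt
      rw [take_sum lam k hk] at h
      refine absurd (card_lt_card ?_) (not_lt.2 h)
      rw [ssubset_iff_of_subset]
      · exact ⟨c, by simp only [mem_filter]; exact ⟨hc, by omega⟩, by simp⟩
      · intro d hd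
        simp only [mem_filter] at hd ⊢
        refine ⟨hd.1, ?_⟩
        have e1 := shiftedColumn_eq lam hd.1
        have e2 := shiftedColumn_eq lam hc
        omega
    · intro hk
      refine ⟨by omega, ?_⟩
      rw [take_sum lam k (by omega)]
      refine card_le_card fun d hd => ?_
      simp only [mem_filter] at hd ⊢
      refine ⟨hd.1, Or.inl ?_⟩
      have e1 := shiftedColumn_eq lam hd.1
      have e2 := shiftedColumn_eq lam hc
      omega
  rw [this, card_range]

lemma blockIndex_ggg (lam : YoungDiagram) {p : Fin lam.card × Fin lam.card} (hp : p ∈ ggg lam) :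
    blockIndex (ctrComposition lam) p.2 = blockIndex (ctrComposition lam) p.1 + 1 := by
  simp only [ggg, mem_filter, mem_univ, true_and] at hp
  obtain ⟨c, hc, hc', h1, h2⟩ := hp
  rw [h1, h2, blockIndex_entry lam hc, blockIndex_entry lam hc']
  have h1 := YoungDiagram.mem_iff_lt_rowLen.1 ((YoungDiagram.mem_cells _).1 hc)
  have h2 := lam.rowLen_anti 0 c.1 (Nat.zero_le c.1)
  simp only [shiftedColumn]
  omega

/-! ### The generalized Gelfand–Graev representation -/

/-- The linear character `γ_lam` of `U_{ctr(lam')}`: `u ↦ ∏ ϑ(u_{ab})` over the arcs `a ⌢ b` of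
`ggg(lam)`. -/
noncomputable def gamma {F : Type*} [Field F] (ϑ : AddChar F ℂ) (lam : YoungDiagram) :
    unipotentRadical lam.card F (ctrComposition lam) →* ℂ where
  toFun u := ∏ p ∈ ggg lam, ϑ (u.val.val p.1 p.2)
  map_one' := by
    refine prod_eq_one fun p hp => ?_
    have hne : p.1 ≠ p.2 := by
      intro h
      have := blockIndex_ggg lam hp
      rw [h] at this
      omega
    simp [Matrix.one_apply_ne hne]
  map_mul' := by
    intro u v
    rw [← prod_mul_distrib]
    refine prod_congr rfl fun p hp => ?_
    have hb := blockIndex_ggg lam hp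
    have hne : p.1 ≠ p.2 := by
      intro h
      rw [h] at hb
      omega
    rw [← AddChar.map_add_eq_mul]
    congr 1
    have e : (u * v).val.val =
        u.val.val + v.val.val - 1 + (u.val.val - 1) * (v.val.val - 1) := by
      rw [Subgroup.coe_mul, Units.val_mul]; noncomm_ring
    rw [e, Matrix.add_apply, Matrix.sub_apply, Matrix.add_apply, Matrix.one_apply_ne hne,
      Matrix.mul_apply, sum_eq_zero, add_zero, sub_zero]
    intro k _
    by_contra h
    have h1 := u.2 p.1 k (left_ne_zero_of_mul h)
    have h2 := v.2 k p.2 (right_ne_zero_of_mul h)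
    omega

/-- The one-dimensional representation of `U_{ctr(lam')}` on `ℂ` through `γ_lam`. -/
noncomputable def gammaRep {F : Type*} [Field F] (ϑ : AddChar F ℂ) (lam : YoungDiagram) :
    Representation ℂ (unipotentRadical lam.card F (ctrComposition lam)) ℂ :=
  (Algebra.lmul ℂ ℂ).toMonoidHom.comp (gamma ϑ lam)

/-- The character of the generalized Gelfand–Graev representation
`Γ_lam = Ind (γ_lam)`, induced from `U_{ctr(lam')}` to the general linear group. -/
noncomputable def gggCharacter {F : Type*} [Field F] (ϑ : AddChar F ℂ) (lam : YoungDiagram)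
    (g : GL (Fin lam.card) F) : ℂ :=
  (Representation.ind (unipotentRadical lam.card F (ctrComposition lam)).subtype
    (gammaRep ϑ lam)).character g

/-! ### Jordan type and dominance order -/

/-- `u` is unipotent of Jordan type `mu`: there is a basis, indexed by the boxes of `mu`, in which
every row of `mu` spans a Jordan block of `u` with eigenvalue `1`. -/
def HasJordanType {n : ℕ} {F : Type*} [Field F] (u : GL (Fin n) F) (mu : YoungDiagram) : Prop :=
  ∃ b : Module.Basis {c : ℕ × ℕ // c ∈ mu} F (Fin n → F),
    (∀ (i : ℕ) (h : (i, 0) ∈ mu), (u.val - 1).mulVec (b ⟨(i, 0), h⟩) = 0) ∧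
    ∀ (i j : ℕ) (h : (i, j + 1) ∈ mu), (u.val - 1).mulVec (b ⟨(i, j + 1), h⟩) =
      b ⟨(i, j), mu.up_left_mem le_rfl (Nat.le_succ j) h⟩

/-- The dominance order `mu ⪯ lam` on partitions (of the same size). -/
def DominatedBy (mu lam : YoungDiagram) : Prop :=
  ∀ k : ℕ, ∑ i ∈ range k, mu.rowLen i ≤ ∑ i ∈ range k, lam.rowLen i

end GGG

namespace GGG

open Finset

/-! ### The character of an induced representation -/

/-! By the Frobenius formula, |U| Γ_λ(u) is the sum of γ_λ, extended by zero, over all conjugates h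
u h⁻¹ (`card_mul_gggCharacter`). (a) If u lies in U, then N = u - 1 lowers the standard flag, whose
quotients have the column lengths of the centered shape as dimensions. Each quotient meets the span
of k Jordan blocks in dimension at most k. This bounds the first k parts of μ by those of λ, so for
other μ every term of the sum vanishes. (b) Instead of evaluating at one element, average over the
elements 1 + X with X adapted: of degree one for the columns, triangular for a chosen order of the
rows, nonzero at the arcs. All of them have Jordan type λ (`IsAdapted.exists_isJordanBasis`), so Γ_λ
takes the same value at each. If g conjugates one of them into U, then g is block upper triangular,
because a flag with the right dimensions lowered by X is unique (`flag_eq_coordFlag`). For such g,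
γ_λ at g(1 + X)g⁻¹ is ϑ(tr(ZX)), where Z = g⁻¹Yg and Y is the transposed arc matrix. The sum over X
factors over matrix entries. A free entry forces the corresponding entry of Z to vanish, or else the
sum is 0; an arc entry runs over nonzero scalars and contributes -1 if its entry of Z is nonzero.
The crux, `conj_arcMatrix_ne_zero`, says that the arc entries of Z are nonzero once those at the
free positions vanish. Hence each g contributes either 0 or one fixed nonzero constant; g = 1
contributes the constant, so nothing cancels. -/

lemma trace_comp_eq_of_comp_eq_smul {k M Q : Type*} [Field k] [AddCommGroup M] [Module k M]
    [FiniteDimensional k M] [AddCommGroup Q] [Module k Q] (q : M →ₗ[k] Q)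
    (hq : Function.Surjective q) (T e : M →ₗ[k] M) (T' : Q →ₗ[k] Q) (hT : q ∘ₗ T = T' ∘ₗ q)
    (c : k) (he : q ∘ₗ e = c • q) (hk : LinearMap.ker q ≤ LinearMap.ker e) :
    LinearMap.trace k M (T ∘ₗ e) = c * LinearMap.trace k Q T' := by
  have : FiniteDimensional k Q := Module.Finite.of_surjective q hq
  obtain ⟨s, hs⟩ := q.exists_rightInverse_of_surjective (LinearMap.range_eq_top.2 hq)
  have hs' : ∀ y, q (s y) = y := fun y => by simpa using LinearMap.congr_fun hs y
  have h1 : q ∘ₗ (T ∘ₗ e ∘ₗ s) = c • T' := by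
    ext y
    have a := LinearMap.congr_fun hT (e (s y))
    have b := LinearMap.congr_fun he (s y)
    simp only [LinearMap.comp_apply, LinearMap.smul_apply] at a b ⊢
    rw [a, b, hs', map_smul]
  -- Since `e` kills the kernel of `q`, `T ∘ e` factors through `Q`; cyclicity of the trace then
  -- moves the computation to `Q`.
  have h2 : (T ∘ₗ e ∘ₗ s) ∘ₗ q = T ∘ₗ e := by
    ext x
    simp only [LinearMap.comp_apply]
    congr 1
    rw [← sub_eq_zero, ← map_sub]
    apply hk
    simp [hs']
  rw [← h2, LinearMap.trace_comp_comm', h1, map_smul, smul_eq_mul]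

open scoped TensorProduct MonoidAlgebra in
-- The induced representation is the space of coinvariants of `U` on `ℂ[G] ⊗ ℂ`. The norm of `U`
-- kills the kernel of the projection and induces multiplication by |U| on the quotient, so the
-- trace can be read off in the basis `G` upstairs.
lemma card_mul_character_ind {G : Type*} [Group G] [Fintype G] (U : Subgroup G)
    (χ : U →* ℂ) (g : G) [DecidablePred (· ∈ U)] :
    (Fintype.card U : ℂ) * (Representation.ind U.subtype
      ((Algebra.lmul ℂ ℂ).toMonoidHom.comp χ : Representation ℂ U ℂ)).character g =
      ∑ h : G, if hh : h * g * h⁻¹ ∈ U then χ ⟨_, hh⟩ else 0 := by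
  classical
  set σ : Representation ℂ U ℂ := (Algebra.lmul ℂ ℂ).toMonoidHom.comp χ with hσ
  have hσ' : ∀ u a, σ u a = χ u * a := fun u a => rfl
  set τ := Representation.tprod ((Representation.leftRegular ℂ G).comp U.subtype) σ with hτ
  let T : ℂ[G] ⊗[ℂ] ℂ →ₗ[ℂ] ℂ[G] ⊗[ℂ] ℂ :=
    (MonoidAlgebra.mapDomainLinearMap ℂ ℂ fun x => x * g⁻¹).rTensor _
  let b : Module.Basis G ℂ (ℂ[G] ⊗[ℂ] ℂ) :=
    Module.Basis.ofRepr ((TensorProduct.rid ℂ _).trans (MonoidAlgebra.coeffLinearEquiv ℂ))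
  have hb : ∀ h, b h = MonoidAlgebra.single h 1 ⊗ₜ 1 := by
    intro h
    simp [b]
  have hfin : FiniteDimensional ℂ (ℂ[G] ⊗[ℂ] ℂ) := b.finiteDimensional_of_finite
  have key := trace_comp_eq_of_comp_eq_smul (Representation.Coinvariants.mk τ)
    (Representation.Coinvariants.mk_surjective τ) T τ.norm (Representation.ind U.subtype σ g)
    (by ext; rfl) (Fintype.card U : ℂ) ?_ ?_
  · rw [Representation.character, ← key, LinearMap.trace_eq_matrix_trace ℂ b, Matrix.trace]
    refine Finset.sum_congr rfl fun h _ => ?_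
    rw [Matrix.diag_apply, LinearMap.toMatrix_apply]
    have h1 : ∀ u : U, T (τ u (b h)) = χ u • b (u * h * g⁻¹) := by
      intro u
      simp [hb, hτ, T, hσ', ← TensorProduct.tmul_smul]
    simp only [LinearMap.comp_apply, Representation.norm, LinearMap.sum_apply, map_sum, h1,
      Finsupp.finsetSum_apply, map_smul, Finsupp.smul_apply, Module.Basis.repr_self, smul_eq_mul,
      Finsupp.single_apply, mul_ite, mul_one, mul_zero]
    -- The diagonal coefficient at `h` needs u h g⁻¹ = h, so only u = h g h⁻¹ can contribute.
    split_ifs with hh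
    · rw [Finset.sum_eq_single ⟨_, hh⟩]
      · rw [if_pos]; group
      · intro u _ hu
        refine if_neg fun e => hu (Subtype.ext ?_)
        exact eq_mul_inv_iff_mul_eq.2 (mul_inv_eq_iff_eq_mul.1 e)
      · simp
    · refine Finset.sum_eq_zero fun u _ => if_neg fun e => hh ?_
      rw [← eq_mul_inv_iff_mul_eq.2 (mul_inv_eq_iff_eq_mul.1 e)]
      exact u.2
  · ext x
    simp [Representation.norm, Nat.cast_smul_eq_nsmul]
  · intro x hx
    refine (Submodule.span_le.2 ?_ : Representation.Coinvariants.ker τ ≤ _)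
      ((Representation.Coinvariants.mk_eq_zero τ).1 hx)
    rintro _ ⟨⟨u, y⟩, rfl⟩
    simp

end GGG

namespace GGG

open Finset

/-! ### Nilpotent endomorphisms with a Jordan basis -/

/-- `b` is a Jordan basis of the nilpotent endomorphism `N`, with one block for each row. -/
structure IsJordanBasis {F V : Type*} [Field F] [AddCommGroup V] [Module F V] (N : Module.End F V)
    {mu : YoungDiagram} (b : Module.Basis {c : ℕ × ℕ // c ∈ mu} F V) : Prop where
  map_zero : ∀ (i : ℕ) (h : (i, 0) ∈ mu), N (b ⟨(i, 0), h⟩) = 0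
  map_succ : ∀ (i j : ℕ) (h : (i, j + 1) ∈ mu),
    N (b ⟨(i, j + 1), h⟩) = b ⟨(i, j), mu.up_left_mem le_rfl (Nat.le_succ j) h⟩

instance (mu : YoungDiagram) : Fintype {c : ℕ × ℕ // c ∈ mu} :=
  inferInstanceAs (Fintype {c : ℕ × ℕ // c ∈ mu.cells})

namespace IsJordanBasis

variable {F V : Type*} [Field F] [AddCommGroup V] [Module F V] {N : Module.End F V}
  {mu : YoungDiagram} {b : Module.Basis {c : ℕ × ℕ // c ∈ mu} F V}

lemma pow_apply (h : IsJordanBasis N b) (k i j : ℕ) (hc : (i, j + k) ∈ mu) :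
    (N ^ k) (b ⟨(i, j + k), hc⟩) = b ⟨(i, j), mu.up_left_mem le_rfl (Nat.le_add_right j k) hc⟩ := by
  induction k with
  | zero => rfl
  | succ k ih => exact (congrArg (N ^ k) (h.map_succ i (j + k) hc)).trans (ih _)

/-- The dual form of the shift: only the basis vector at `(i, j + 1)` is sent to the one at `(i,
j)`. It detects kernels and flag membership coordinatewise. -/
lemma repr_apply (h : IsJordanBasis N b) (v : V) (i j : ℕ) (hc : (i, j + 1) ∈ mu) :
    b.repr (N v) ⟨(i, j), mu.up_left_mem le_rfl (Nat.le_succ j) hc⟩ =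
      b.repr v ⟨(i, j + 1), hc⟩ := by
  suffices H : Finsupp.lapply ⟨(i, j), mu.up_left_mem le_rfl (Nat.le_succ j) hc⟩ ∘ₗ
      b.repr.toLinearMap ∘ₗ N = Finsupp.lapply ⟨(i, j + 1), hc⟩ ∘ₗ b.repr.toLinearMap from
    LinearMap.congr_fun H v
  refine b.ext ?_
  rintro ⟨⟨i', j'⟩, h'⟩
  cases j' with
  | zero => simp [h.map_zero]
  | succ j' => simp [h.map_succ, Finsupp.single_apply]

lemma repr_pow_apply (h : IsJordanBasis N b) (k : ℕ) (v : V) (i j : ℕ) (hc : (i, j + k) ∈ mu) :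
    b.repr ((N ^ k) v) ⟨(i, j), mu.up_left_mem le_rfl (Nat.le_add_right j k) hc⟩ =
      b.repr v ⟨(i, j + k), hc⟩ := by
  induction k generalizing v with
  | zero => rfl
  | succ k ih =>
    rw [pow_succ, Module.End.mul_apply, ih (N v) (mu.up_left_mem le_rfl (Nat.le_succ _) hc)]
    exact h.repr_apply v i (j + k) hc

end IsJordanBasis

/-! ### Dominance inequalities from flags -/

lemma card_rows (mu : YoungDiagram) (k : ℕ) :
    #{c ∈ mu.cells | c.1 < k} = ∑ i ∈ range k, mu.rowLen i := by
  induction k with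
  | zero => simp
  | succ k ih =>
    rw [sum_range_succ, ← ih, mu.rowLen_eq_card, ← card_union_of_disjoint]
    · congr 1
      ext c
      simp only [mem_filter, mem_union, YoungDiagram.mem_cells, YoungDiagram.mem_row_iff,
        Nat.lt_succ_iff_lt_or_eq]
      tauto
    · rw [disjoint_left]
      intro c hc hc'
      simp only [mem_filter, YoungDiagram.mem_row_iff] at hc hc'
      omega

open Module in
/-- The size of the first `k` Jordan blocks is bounded in terms of a flag whose members are
mapped into their predecessors. -/
lemma sum_rowLen_le_sum_min {F V : Type*} [Field F] [AddCommGroup V] [Module F V]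
    [FiniteDimensional F V] {N : Module.End F V} {mu : YoungDiagram}
    {b : Module.Basis {c : ℕ × ℕ // c ∈ mu} F V} (h : IsJordanBasis N b)
    (E : ℕ → Submodule F V) (h0 : E 0 = ⊥) (m : ℕ) (hm : E m = ⊤) (hE : Monotone E)
    (hN : ∀ k, ∀ v ∈ E (k + 1), N v ∈ E k) (k : ℕ) :
    ∑ i ∈ range k, mu.rowLen i ≤
      ∑ j ∈ range m, min k (finrank F (E (j + 1)) - finrank F (E j)) := by
  classical
  let R : Set {c : ℕ × ℕ // c ∈ mu} := {c | c.1.1 < k}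
  -- The sum of the first `k` Jordan blocks, on which `N` has nullity at most `k`.
  let W : Submodule F V := Submodule.span F (b '' R)
  have hfin : ∀ S : Set {c : ℕ × ℕ // c ∈ mu},
      finrank F (Submodule.span F (b '' S)) = #{c ∈ mu.cells | ∃ h, ⟨c, h⟩ ∈ S} := by
    intro S
    rw [Set.image_eq_range]
    refine (finrank_span_eq_card (b.linearIndependent.comp (Subtype.val : S → _)
      Subtype.val_injective)).trans ?_
    rw [← card_univ]
    refine card_bij (fun c _ => c.1.1) ?_ ?_ ?_
    · rintro ⟨⟨c, hc⟩, hS⟩ _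
      simp only [mem_filter, YoungDiagram.mem_cells]
      exact ⟨hc, hc, hS⟩
    · intro c _ c' _ hcc
      exact Subtype.ext (Subtype.ext hcc)
    · intro c hc
      obtain ⟨-, h, hS⟩ := mem_filter.1 hc
      exact ⟨⟨⟨c, h⟩, hS⟩, mem_univ _, rfl⟩
  have hW : finrank F W = ∑ i ∈ range k, mu.rowLen i := by
    rw [← card_rows, hfin]
    congr 1
    ext c
    simp only [mem_filter, YoungDiagram.mem_cells, R, Set.mem_ofPred_eq]
    exact and_congr_right fun hc => ⟨fun ⟨_, h⟩ => h, fun h => ⟨hc, h⟩⟩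
  have hNW : ∀ v ∈ W, N v ∈ W := by
    intro v hv
    refine (Submodule.span_le.2 ?_ : W ≤ W.comap N) hv
    rintro _ ⟨⟨⟨i, j⟩, hc⟩, hi, rfl⟩
    cases j with
    | zero => simp [h.map_zero]
    | succ j =>
      simp only [Submodule.comap_coe, Set.mem_preimage, h.map_succ]
      exact Submodule.subset_span ⟨⟨(i, j), _⟩, hi, rfl⟩
  have hker : finrank F (W ⊓ LinearMap.ker N : Submodule F V) ≤ k := by
    have hle : W ⊓ LinearMap.ker N ≤ Submodule.span F (b '' {c | c.1.1 < k ∧ c.1.2 = 0}) := by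
      rintro v ⟨hv, hv'⟩
      replace hv := b.mem_span_image.1 hv
      rw [Module.Basis.mem_span_image]
      intro c hc
      refine ⟨hv hc, ?_⟩
      obtain ⟨⟨i, j⟩, hij⟩ := c
      cases j with
      | zero => rfl
      | succ j =>
        refine absurd ?_ (Finsupp.mem_support_iff.1 hc)
        rw [← h.repr_apply, LinearMap.mem_ker.1 hv']
        simp
    refine (Submodule.finrank_mono hle).trans ?_
    rw [hfin]
    calc _ ≤ #((range k).image fun i => (i, 0)) := by
          refine card_le_card ?_
          rintro ⟨i, j⟩ hc
          simp only [mem_filter, Set.mem_ofPred_eq] at hc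
          obtain ⟨_, _, h1, h2⟩ := hc
          simp [h1, h2]
      _ ≤ k := card_image_le.trans (by simp)
  -- The bound by `k` holds because `N` maps the larger intersection to the smaller with kernel
  -- inside `W ⊓ ker N`; the other because the quotient of the intersections embeds in that of the
  -- flag.
  have hstep : ∀ j, finrank F (W ⊓ E (j + 1) : Submodule F V) ≤
      finrank F (W ⊓ E j : Submodule F V) + min k (finrank F (E (j + 1)) - finrank F (E j)) := by
    intro j
    rw [← min_add_add_left, le_min_iff]
    constructor
    · let f : (W ⊓ E (j + 1) : Submodule F V) →ₗ[F] (W ⊓ E j : Submodule F V) :=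
        N.restrict fun v hv => ⟨hNW v hv.1, hN j v hv.2⟩
      rw [← f.finrank_range_add_finrank_ker]
      refine add_le_add (Submodule.finrank_le _) (le_trans ?_ hker)
      refine LinearMap.finrank_le_finrank_of_injective
        (f := (Submodule.subtype _ ∘ₗ Submodule.subtype _).codRestrict
          (W ⊓ LinearMap.ker N : Submodule F V) ?_) ?_
      · rintro ⟨⟨v, hv⟩, hv'⟩
        refine ⟨hv.1, ?_⟩
        exact congrArg Subtype.val (LinearMap.mem_ker.1 hv')
      · intro x y hxy
        exact Subtype.ext (Subtype.ext (congrArg (fun z => z.1) hxy))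
    · have h1 := Submodule.finrank_sup_add_finrank_inf_eq (W ⊓ E (j + 1)) (E j)
      have h2 : W ⊓ E (j + 1) ⊓ E j = W ⊓ E j := by
        rw [inf_assoc, inf_eq_right.2 (hE (Nat.le_succ j))]
      have h3 := Submodule.finrank_mono (R := F) (sup_le inf_le_right (hE (Nat.le_succ j)) :
        (W ⊓ E (j + 1)) ⊔ E j ≤ E (j + 1))
      rw [h2] at h1
      omega
  have hsum : ∀ m, finrank F (W ⊓ E m : Submodule F V) ≤
      ∑ j ∈ range m, min k (finrank F (E (j + 1)) - finrank F (E j)) := by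
    intro m
    induction m with
    | zero => simp [h0]
    | succ m ih => rw [sum_range_succ]; exact (hstep m).trans (by omega)
  have := hsum m
  rwa [hm, inf_top_eq, hW] at this

/-- Longer rows cover shorter ones. If a column meets some row of index at least `k`, it meets all
of the first `k` rows; otherwise all its boxes lie in those rows. -/
lemma sum_min_card_shiftedColumn (lam : YoungDiagram) (k : ℕ) :
    ∑ j ∈ range (lam.rowLen 0), min k #{c ∈ lam.cells | shiftedColumn lam c = j} ≤
      ∑ i ∈ range k, lam.rowLen i := by
  rw [← card_rows, card_eq_sum_card_fiberwise (f := shiftedColumn lam) (t := range (lam.rowLen 0))]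
  · refine sum_le_sum fun j _ => ?_
    by_cases H : ∃ c ∈ lam.cells, shiftedColumn lam c = j ∧ k ≤ c.1
    · obtain ⟨⟨r, s⟩, hc, hj, hk⟩ := H
      have h1 := YoungDiagram.mem_iff_lt_rowLen.1 ((YoungDiagram.mem_cells _).1 hc)
      refine (min_le_left _ _).trans ?_
      refine (card_range k).symm.trans_le ?_
      refine card_le_card_of_injOn
        (fun i => (i, s + lam.rowLen i / 2 - lam.rowLen r / 2)) ?_ ?_
      · intro i hi
        have h2 := lam.rowLen_anti 0 i (Nat.zero_le i)
        simp only [coe_range, Set.mem_Iio] at hi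
        have h3 := lam.rowLen_anti i r (by simp only at hk; omega)
        simp only [shiftedColumn] at hj
        refine mem_coe.2 (mem_filter.2 ⟨mem_filter.2 ⟨(YoungDiagram.mem_cells _).2
          (YoungDiagram.mem_iff_lt_rowLen.2 ?_), hi⟩, ?_⟩)
        · omega
        · simp only [shiftedColumn]
          omega
      · intro i _ i' _ h
        exact congrArg Prod.fst h
    · push Not at H
      refine (min_le_right _ _).trans (card_le_card ?_)
      intro c hc
      simp only [mem_filter] at hc ⊢
      exact ⟨⟨hc.1, H c hc.1 hc.2⟩, hc.2⟩
  · intro c hc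
    simp only [coe_filter, YoungDiagram.mem_cells, Set.mem_ofPred_eq] at hc
    have h1 := YoungDiagram.mem_iff_lt_rowLen.1 hc.1
    have h2 := lam.rowLen_anti 0 c.1 (Nat.zero_le c.1)
    simp only [coe_range, Set.mem_Iio, shiftedColumn]
    omega

end GGG

namespace GGG

open Finset

/-! ### Indices as boxes -/

lemma entry_lt_entry (lam : YoungDiagram) {c d : ℕ × ℕ} (hc : c ∈ lam)
    (h : halfColumn lam c < halfColumn lam d ∨ (halfColumn lam c = halfColumn lam d ∧ c.1 < d.1)) :
    entry lam c < entry lam d := by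
  refine card_lt_card ((ssubset_iff_of_subset ?_).2 ⟨c, ?_, ?_⟩)
  · intro e he
    simp only [mem_filter] at he ⊢
    exact ⟨he.1, by omega⟩
  · exact mem_filter.2 ⟨hc, h⟩
  · simp

lemma entry_injOn (lam : YoungDiagram) {c d : ℕ × ℕ} (hc : c ∈ lam) (hd : d ∈ lam)
    (h : entry lam c = entry lam d) : c = d := by
  have h1 := mt (entry_lt_entry lam (d := d) hc) (by omega)
  have h2 := mt (entry_lt_entry lam (d := c) hd) (by omega)
  have h3 : c.1 = d.1 := by omega
  have h4 : halfColumn lam c = halfColumn lam d := by omega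
  simp only [halfColumn, h3] at h4
  exact Prod.ext h3 (by omega)

lemma entry_lt_card (lam : YoungDiagram) {c : ℕ × ℕ} (hc : c ∈ lam) : entry lam c < lam.card := by
  refine card_lt_card ((ssubset_iff_of_subset (filter_subset _ _)).2 ⟨c, hc, ?_⟩)
  simp

/-- The numbering of the boxes. -/
noncomputable def entryEquiv (lam : YoungDiagram) : {c : ℕ × ℕ // c ∈ lam} ≃ Fin lam.card :=
  Equiv.ofBijective (fun c => ⟨entry lam c, entry_lt_card lam c.2⟩) <| by
    rw [Fintype.bijective_iff_injective_and_card]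
    refine ⟨fun c d h => Subtype.ext (entry_injOn lam c.2 d.2 (congrArg Fin.val h)), ?_⟩
    rw [Fintype.card_fin]
    exact Fintype.card_coe lam.cells

/-- The row of the box with a given number. -/
noncomputable def row (lam : YoungDiagram) (a : Fin lam.card) : ℕ := ((entryEquiv lam).symm a).1.1

/-- The column, in the shape with permuted columns, of the box with a given number. -/
noncomputable def col (lam : YoungDiagram) (a : Fin lam.card) : ℕ :=
  shiftedColumn lam ((entryEquiv lam).symm a).1

/-- The column, in the shape with permuted columns, in which a row starts. -/
def start (lam : YoungDiagram) (r : ℕ) : ℕ := lam.rowLen 0 / 2 - lam.rowLen r / 2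

lemma shiftedColumn_eq_add_start (lam : YoungDiagram) (c : ℕ × ℕ) :
    shiftedColumn lam c = c.2 + start lam c.1 := by
  have := lam.rowLen_anti 0 c.1 (Nat.zero_le _)
  simp only [shiftedColumn, start]
  omega

variable {lam : YoungDiagram}

lemma start_add_rowLen_le (r : ℕ) : start lam r + lam.rowLen r ≤ lam.rowLen 0 := by
  have := lam.rowLen_anti 0 r (Nat.zero_le _)
  simp only [start]
  omega

/-- With `start_add_rowLen_mono`: the column intervals occupied by the rows are nested according to
length. -/
lemma start_le_start {r s : ℕ} (h : lam.rowLen s ≤ lam.rowLen r) : start lam r ≤ start lam s := by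
  simp only [start]
  omega

lemma start_add_rowLen_mono {r s : ℕ} (h : lam.rowLen s ≤ lam.rowLen r) :
    start lam s + lam.rowLen s ≤ start lam r + lam.rowLen r := by
  have := lam.rowLen_anti 0 r (Nat.zero_le _)
  simp only [start]
  omega

lemma row_entryEquiv (c : {c : ℕ × ℕ // c ∈ lam}) : row lam (entryEquiv lam c) = c.1.1 := by
  simp [row]

lemma col_entryEquiv (c : {c : ℕ × ℕ // c ∈ lam}) :
    col lam (entryEquiv lam c) = c.1.2 + start lam c.1.1 := by
  simp [col, shiftedColumn_eq_add_start]

lemma start_le_col (a : Fin lam.card) : start lam (row lam a) ≤ col lam a := by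
  rw [col, shiftedColumn_eq_add_start]
  exact Nat.le_add_left _ _

lemma col_lt (a : Fin lam.card) : col lam a < start lam (row lam a) + lam.rowLen (row lam a) := by
  have := YoungDiagram.mem_iff_lt_rowLen.1 ((entryEquiv lam).symm a).2
  rw [col, shiftedColumn_eq_add_start]
  change ((entryEquiv lam).symm a).1.2 + start lam (row lam a) < _
  change ((entryEquiv lam).symm a).1.2 < lam.rowLen (row lam a) at this
  omega

lemma exists_index {r k : ℕ} (h : start lam r ≤ k) (h' : k < start lam r + lam.rowLen r) :
    ∃ a : Fin lam.card, row lam a = r ∧ col lam a = k := by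
  have hc : (r, k - start lam r) ∈ lam := YoungDiagram.mem_iff_lt_rowLen.2 (by omega)
  refine ⟨entryEquiv lam ⟨_, hc⟩, row_entryEquiv _, ?_⟩
  rw [col_entryEquiv]
  simp only
  omega

lemma index_ext {a b : Fin lam.card} (h : row lam a = row lam b) (h' : col lam a = col lam b) :
    a = b := by
  apply (entryEquiv lam).symm.injective
  refine Subtype.ext (Prod.ext h ?_)
  rw [col, col, shiftedColumn_eq_add_start, shiftedColumn_eq_add_start] at h'
  change _ + start lam (row lam a) = _ + start lam (row lam b) at h'
  rw [h] at h'
  omega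

lemma blockIndex_eq_col (a : Fin lam.card) : blockIndex (ctrComposition lam) a = col lam a := by
  obtain ⟨c, rfl⟩ := (entryEquiv lam).surjective a
  rw [col, Equiv.symm_apply_apply]
  exact blockIndex_entry lam c.2

lemma mem_ggg_iff {a b : Fin lam.card} :
    (a, b) ∈ ggg lam ↔ row lam a = row lam b ∧ col lam b = col lam a + 1 := by
  obtain ⟨⟨⟨i, j⟩, hc⟩, rfl⟩ := (entryEquiv lam).surjective a
  obtain ⟨⟨⟨i', j'⟩, hd⟩, rfl⟩ := (entryEquiv lam).surjective b
  simp only [row_entryEquiv, col_entryEquiv, ggg, mem_filter, mem_univ, true_and]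
  constructor
  · rintro ⟨e, he, he', h1, h2⟩
    have h3 := entry_injOn lam hc he h1
    have h4 := entry_injOn lam hd he' h2
    subst h3
    simp only [Prod.mk.injEq] at h4
    obtain ⟨rfl, rfl⟩ := h4
    exact ⟨rfl, by omega⟩
  · rintro ⟨rfl, h⟩
    have : j' = j + 1 := by omega
    subst this
    exact ⟨(i, j), hc, hd, rfl, rfl⟩

lemma mem_unipotentRadical_iff {F : Type*} [Field F] {u : GL (Fin lam.card) F} :
    u ∈ unipotentRadical lam.card F (ctrComposition lam) ↔
      ∀ a b, (u.val - 1) a b ≠ 0 → col lam a < col lam b := by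
  change (∀ a b, _ → _) ↔ _
  simp only [blockIndex_eq_col]

lemma card_shiftedColumn_filter (p : ℕ → Prop) [DecidablePred p] :
    #{a : Fin lam.card | p (col lam a)} = #{c ∈ lam.cells | p (shiftedColumn lam c)} := by
  refine card_bij (fun a _ => ((entryEquiv lam).symm a).1) ?_ ?_ ?_
  · intro a ha
    simp only [mem_filter, mem_univ, true_and] at ha ⊢
    exact ⟨((entryEquiv lam).symm a).2, ha⟩
  · intro a _ b _ h
    exact (entryEquiv lam).symm.injective (Subtype.ext h)
  · intro c hc
    obtain ⟨h1, h2⟩ := mem_filter.1 hc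
    refine ⟨entryEquiv lam ⟨c, h1⟩, ?_, by simp⟩
    refine mem_filter.2 ⟨mem_univ _, ?_⟩
    simpa [col] using h2

/-! ### Coordinate flags -/

/-- The vectors all of whose coordinates of degree at least `k` vanish. -/
def coordFlag {F V ι : Type*} [Field F] [AddCommGroup V] [Module F V] (b : Module.Basis ι F V)
    (f : ι → ℕ) (k : ℕ) : Submodule F V where
  carrier := {v | ∀ c, k ≤ f c → b.repr v c = 0}
  zero_mem' := by simp
  add_mem' := by
    intro v w hv hw c hc
    simp [hv c hc, hw c hc]
  smul_mem' := by
    intro t v hv c hc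
    simp [hv c hc]

section coordFlag

variable {F V ι : Type*} [Field F] [AddCommGroup V] [Module F V] (b : Module.Basis ι F V)
    (f : ι → ℕ)

lemma mem_coordFlag {k : ℕ} {v : V} : v ∈ coordFlag b f k ↔ ∀ c, k ≤ f c → b.repr v c = 0 :=
  Iff.rfl

lemma coordFlag_eq_span (k : ℕ) : coordFlag b f k = Submodule.span F (b '' {c | f c < k}) := by
  ext v
  rw [b.mem_span_image, mem_coordFlag]
  constructor
  · intro h c hc
    by_contra hlt
    exact Finsupp.mem_support_iff.1 hc (h c (not_lt.1 hlt))
  · intro h c hc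
    by_contra hne
    exact absurd (h (Finsupp.mem_support_iff.2 hne)) (not_lt.2 hc)

lemma finrank_coordFlag [Fintype ι] (k : ℕ) :
    Module.finrank F (coordFlag b f k) = #{c | f c < k} := by
  rw [coordFlag_eq_span, Set.image_eq_range]
  refine (finrank_span_eq_card (b.linearIndependent.comp (Subtype.val : {c | f c < k} → _)
    Subtype.val_injective)).trans ?_
  exact Fintype.card_subtype _

lemma coordFlag_mono : Monotone (coordFlag b f) :=
  fun _ _ h _ hv c hc => hv c (h.trans hc)

lemma coordFlag_zero : coordFlag b f 0 = ⊥ := by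
  refine (Submodule.eq_bot_iff _).2 fun v hv => ?_
  exact b.repr.map_eq_zero_iff.1 (Finsupp.ext fun c => hv c (Nat.zero_le _))

lemma coordFlag_eq_top {m : ℕ} (h : ∀ c, f c < m) : coordFlag b f m = ⊤ :=
  (Submodule.eq_top_iff'.2 fun _ c hc => absurd hc (not_le.2 (h c)))

end coordFlag

/-- The standard flag whose members are preserved by the group of block upper triangular
matrices. -/
noncomputable def stdFlag (F : Type*) [Field F] (lam : YoungDiagram) (k : ℕ) :
    Submodule F (Fin lam.card → F) :=
  coordFlag (Pi.basisFun F _) (col lam) k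

lemma mem_stdFlag {F : Type*} [Field F] {k : ℕ} {v : Fin lam.card → F} :
    v ∈ stdFlag F lam k ↔ ∀ a, k ≤ col lam a → v a = 0 := by
  simp only [stdFlag, mem_coordFlag, Pi.basisFun_repr]

lemma mulVec_mem_stdFlag {F : Type*} [Field F] {M : Matrix (Fin lam.card) (Fin lam.card) F}
    (hM : ∀ a b, M a b ≠ 0 → col lam a < col lam b) {k : ℕ} {v : Fin lam.card → F}
    (hv : v ∈ stdFlag F lam (k + 1)) : M.mulVec v ∈ stdFlag F lam k := by
  rw [mem_stdFlag] at hv ⊢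
  intro a ha
  change ∑ b, M a b * v b = 0
  refine sum_eq_zero fun b _ => ?_
  by_contra hne
  have h1 := hM a b (left_ne_zero_of_mul hne)
  exact right_ne_zero_of_mul hne (hv b (by omega))

lemma isJordanBasis_of_hasJordanType {F : Type*} [Field F] {n : ℕ} {mu : YoungDiagram}
    {u : GL (Fin n) F} (h : HasJordanType u mu) :
    ∃ b : Module.Basis {c : ℕ × ℕ // c ∈ mu} F (Fin n → F),
      IsJordanBasis (u.val - 1).mulVecLin b := by
  obtain ⟨b, h0, h1⟩ := h
  exact ⟨b, h0, h1⟩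

/-- The matrix `u - 1` lowers the standard flag, and the quotients of this flag have the column
lengths of the centered shape as dimensions. -/
theorem dominatedBy_of_mem_unipotentRadical {F : Type*} [Field F] {mu : YoungDiagram}
    {u : GL (Fin lam.card) F} (hu : u ∈ unipotentRadical lam.card F (ctrComposition lam))
    (h : HasJordanType u mu) : DominatedBy mu lam := by
  obtain ⟨b, hb⟩ := isJordanBasis_of_hasJordanType h
  intro k
  refine (sum_rowLen_le_sum_min hb (stdFlag F lam) (coordFlag_zero _ _) (lam.rowLen 0)
    (coordFlag_eq_top _ _ fun a => (col_lt a).trans_le (start_add_rowLen_le _))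
    (coordFlag_mono _ _)
    (fun k v hv => mulVec_mem_stdFlag (mem_unipotentRadical_iff.1 hu) hv) k).trans
    (le_trans (sum_le_sum fun j _ => ?_) (sum_min_card_shiftedColumn lam k))
  refine min_le_min_left _ ?_
  rw [stdFlag, stdFlag, finrank_coordFlag, finrank_coordFlag, tsub_le_iff_left,
    ← card_shiftedColumn_filter (fun i => i = j)]
  refine le_trans (card_le_card ?_) (card_union_le _ _)
  intro a ha
  simp only [mem_filter, mem_union, mem_univ, true_and] at ha ⊢
  omega

end GGG

namespace GGG

open Finset Module

/-! ### Uniqueness of the flag of a Richardson element -/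

lemma pow_mem_flag {F V : Type*} [Field F] [AddCommGroup V] [Module F V] {N : End F V}
    {E : ℕ → Submodule F V} (hN : ∀ k, ∀ v ∈ E (k + 1), N v ∈ E k) (i k : ℕ) {v : V}
    (hv : v ∈ E (k + i)) : (N ^ i) v ∈ E k := by
  induction i generalizing v with
  | zero => exact hv
  | succ i ih =>
    rw [pow_succ, End.mul_apply]
    exact ih (hN _ v hv)

/-- The members of the flag are determined from the two ends towards the middle, alternately on the
right and on the left, since centered rows make powers of `N` link opposite columns. One inclusion
at each step suffices, by equality of dimensions. -/
theorem flag_eq_coordFlag {F V : Type*} [Field F] [AddCommGroup V] [Module F V]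
    [FiniteDimensional F V] {N : End F V} {lam : YoungDiagram}
    {b : Basis {c : ℕ × ℕ // c ∈ lam} F V} (h : IsJordanBasis N b) (E : ℕ → Submodule F V)
    (hE : Monotone E) (hN : ∀ k, ∀ v ∈ E (k + 1), N v ∈ E k)
    (hdim : ∀ k, finrank F (E k) =
      finrank F (coordFlag b (fun c => shiftedColumn lam c) k)) (k : ℕ) :
    E k = coordFlag b (fun c => shiftedColumn lam c) k := by
  set A := coordFlag b (fun c => shiftedColumn lam c) with hA
  set m := lam.rowLen 0 with hm
  -- After `d` steps, equality is known outside the interval that a row of length `m - d` would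
  -- occupy.
  suffices H : ∀ d ≤ m, ∀ k, (k ≤ m / 2 - (m - d) / 2 ∨ m / 2 - (m - d) / 2 + (m - d) ≤ k) →
      E k = A k from H m le_rfl k (by omega)
  have hlen : ∀ c : {c : ℕ × ℕ // c ∈ lam}, c.1.2 < lam.rowLen c.1.1 := fun c =>
    YoungDiagram.mem_iff_lt_rowLen.1 c.2
  have hmax : ∀ r, lam.rowLen r ≤ m := fun r => lam.rowLen_anti 0 r (Nat.zero_le r)
  intro d
  induction d with
  | zero =>
    intro _ k hk
    rcases hk with hk | hk
    · have hA0 : A k = ⊥ := by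
        rw [show k = 0 by omega]
        exact coordFlag_zero _ _
      have := hdim k
      rw [hA0, finrank_bot] at this
      rw [hA0, Submodule.finrank_eq_zero.1 this]
    · have hAt : A k = ⊤ := coordFlag_eq_top _ _ fun c => by
        have := start_add_rowLen_le (lam := lam) c.1.1
        rw [shiftedColumn_eq_add_start]
        have := hlen c
        omega
      have := hdim k
      rw [hAt, finrank_top] at this
      rw [hAt, Submodule.eq_top_of_finrank_eq this]
  | succ d ih =>
    intro hd
    have ih := ih (by omega)
    obtain ⟨j, hj⟩ : ∃ j, m - d = j + 1 := ⟨m - d - 1, by omega⟩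
    have hj' : m - (d + 1) = j := by omega
    have hjm : j + 1 ≤ m := by omega
    rw [hj] at ih
    rw [hj']
    set s := m / 2 - (j + 1) / 2 with hs
    rcases Nat.even_or_odd' j with ⟨t, rfl | rfl⟩
    -- A box in column `s + 2 * t` has a box `2 * t` places to its left in its row, in column `s`.
    -- Its coordinate in `v` is a coordinate of `N ^ (2 * t) v`, which vanishes as this vector lies
    -- in `E s = A s`.
    · have hrest : E (s + 2 * t) = A (s + 2 * t) := by
        refine Submodule.eq_of_le_of_finrank_eq ?_ (hdim _)
        intro v hv c hc
        rcases eq_or_lt_of_le hc with hc | hc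
        · have hv' := pow_mem_flag hN (2 * t) s hv
          rw [ih s (Or.inl le_rfl)] at hv'
          obtain ⟨⟨r, i⟩, hri⟩ := c
          have h1 := hlen ⟨(r, i), hri⟩
          have h2 := hmax r
          simp only [shiftedColumn_eq_add_start, start] at hc h1
          obtain ⟨i, rfl⟩ : ∃ i', i = i' + 2 * t := ⟨i - 2 * t, by omega⟩
          rw [← h.repr_pow_apply]
          refine hv' _ ?_
          simp only [shiftedColumn_eq_add_start, start]
          omega
        · have hv' := hE (Nat.le_succ _) hv
          rw [ih (s + 2 * t + 1) (Or.inr le_rfl)] at hv'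
          exact hv' c hc
      intro k hk
      by_cases hk' : k = s + 2 * t
      · rw [hk', hrest]
      · exact ih k (by omega)
    -- A row meeting column `s` continues for `2 * t + 1` more boxes, so the basis vectors of that
    -- column are images under `N ^ (2 * t + 1)` of vectors in a member already identified.
    · have hrest : A (s + 1) = E (s + 1) := by
        refine Submodule.eq_of_le_of_finrank_eq ?_ (hdim _).symm
        rw [hA, coordFlag_eq_span, Submodule.span_le]
        rintro _ ⟨c, hc, rfl⟩
        rcases Nat.lt_succ_iff_lt_or_eq.1 hc with hc | hc
        · refine hE (Nat.le_succ s) ?_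
          rw [ih s (Or.inl le_rfl), hA, coordFlag_eq_span]
          exact Submodule.subset_span ⟨c, hc, rfl⟩
        · obtain ⟨⟨r, i⟩, hri⟩ := c
          have h1 := hlen ⟨(r, i), hri⟩
          have h2 := hmax r
          simp only [shiftedColumn_eq_add_start, start] at hc h1
          have hc' : (r, i + (2 * t + 1)) ∈ lam := YoungDiagram.mem_iff_lt_rowLen.2 (by omega)
          rw [SetLike.mem_coe, ← h.pow_apply (2 * t + 1) r i hc']
          refine pow_mem_flag hN _ _ ?_
          rw [ih _ (Or.inr (by omega)), hA, coordFlag_eq_span]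
          refine Submodule.subset_span ⟨_, ?_, rfl⟩
          simp only [shiftedColumn_eq_add_start, start, Set.mem_ofPred_eq]
          omega
      intro k hk
      by_cases hk' : k = s + 1
      · rw [hk', hrest]
      · exact ih k (by omega)

end GGG

namespace GGG

open Finset Module

variable {lam : YoungDiagram}

/-! ### An ordering of the rows -/

/-- The rows of even length, from top to bottom, come first, followed by the rows of odd length,
from bottom to top. -/
noncomputable def rowKey (lam : YoungDiagram) (r : ℕ) : ℤ :=
  if Even (lam.rowLen r) then (r : ℤ) - lam.colLen 0 else (lam.colLen 0 : ℤ) - r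

/-- The position of the row of the box with a given number. -/
noncomputable def key (lam : YoungDiagram) (a : Fin lam.card) : ℤ := rowKey lam (row lam a)

lemma row_lt (a : Fin lam.card) : row lam a < lam.colLen 0 :=
  YoungDiagram.mem_iff_lt_colLen.1
    (lam.up_left_mem le_rfl (Nat.zero_le _) ((entryEquiv lam).symm a).2)

lemma row_eq_of_key_eq {a b : Fin lam.card} (h : key lam a = key lam b) :
    row lam a = row lam b := by
  have ha := row_lt a
  have hb := row_lt b
  simp only [key, rowKey] at h
  split_ifs at h <;> omega

lemma key_eq_of_row_eq {a b : Fin lam.card} (h : row lam a = row lam b) :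
    key lam a = key lam b := congrArg (rowKey lam) h

lemma eq_of_key_eq {a b : Fin lam.card} (h : key lam a = key lam b) (h' : col lam a = col lam b) :
    a = b :=
  index_ext (row_eq_of_key_eq h) h'

/-- With `rowLen_le_of_le_key`, the purpose of the order: rows before an even row, and rows after an
odd row, are at least as long as it. The two parities are used in opposite directions in
`conj_arcMatrix_ne_zero`. -/
lemma rowLen_le_of_key_le {a b : Fin lam.card} (hb : Even (lam.rowLen (row lam b)))
    (h : key lam a ≤ key lam b) : lam.rowLen (row lam b) ≤ lam.rowLen (row lam a) := by
  have ha := row_lt a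
  have hb' := row_lt b
  apply lam.rowLen_anti
  simp only [key, rowKey, if_pos hb] at h
  split_ifs at h <;> omega

lemma rowLen_le_of_le_key {a b : Fin lam.card} (hb : ¬ Even (lam.rowLen (row lam b)))
    (h : key lam b ≤ key lam a) : lam.rowLen (row lam b) ≤ lam.rowLen (row lam a) := by
  have ha := row_lt a
  have hb' := row_lt b
  apply lam.rowLen_anti
  simp only [key, rowKey, if_neg hb] at h
  split_ifs at h <;> omega

/-! ### Jordan bases of triangular deformations of the standard nilpotent matrix -/

/-- A matrix of degree one for the columns that is triangular for the order on the rows, with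
nonzero entries at the arcs of `ggg lam`. -/
structure IsAdapted {F : Type*} [Field F] (X : Matrix (Fin lam.card) (Fin lam.card) F) : Prop where
  col_eq : ∀ {a b}, X a b ≠ 0 → col lam b = col lam a + 1
  key_le : ∀ {a b}, X a b ≠ 0 → key lam a ≤ key lam b
  ne_zero : ∀ {a b}, row lam a = row lam b → col lam b = col lam a + 1 → X a b ≠ 0

/-- The vector `v` is homogeneous for the columns, with leading coordinate `a` for the order on
the rows. -/
structure IsLeading {F : Type*} [Field F] (a : Fin lam.card) (v : Fin lam.card → F) : Prop where
  ne_zero : v a ≠ 0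
  col_eq : ∀ {c}, v c ≠ 0 → col lam c = col lam a
  key_le : ∀ {c}, v c ≠ 0 → key lam c ≤ key lam a

variable {F : Type*} [Field F] {X : Matrix (Fin lam.card) (Fin lam.card) F}

namespace IsAdapted

/-- No cancellation occurs at `a`: a contributing index has key at least that of `a` by
triangularity and at most that of `b`, and these keys agree, so it is `b`. -/
lemma isLeading_mulVec (hX : IsAdapted X) {a b : Fin lam.card} (h : row lam a = row lam b)
    (h' : col lam b = col lam a + 1) {v : Fin lam.card → F} (hv : IsLeading b v) :
    IsLeading a (X.mulVec v) := by
  have hmem : ∀ c, X.mulVec v c ≠ 0 → ∃ d, X c d ≠ 0 ∧ v d ≠ 0 := by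
    intro c hc
    obtain ⟨d, -, hd⟩ := exists_ne_zero_of_sum_ne_zero (s := univ) (f := fun d => X c d * v d) hc
    exact ⟨d, left_ne_zero_of_mul hd, right_ne_zero_of_mul hd⟩
  refine ⟨?_, ?_, ?_⟩
  · have : X.mulVec v a = X a b * v b := by
      change ∑ d, X a d * v d = _
      refine Fintype.sum_eq_single b fun d hd => ?_
      by_contra hne
      have h1 := left_ne_zero_of_mul hne
      have h2 := right_ne_zero_of_mul hne
      refine hd (eq_of_key_eq (le_antisymm (hv.key_le h2) ?_) (hv.col_eq h2))
      rw [← key_eq_of_row_eq h]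
      exact hX.key_le h1
    rw [this]
    exact mul_ne_zero (hX.ne_zero h h') hv.ne_zero
  · intro c hc
    obtain ⟨d, h1, h2⟩ := hmem c hc
    have h3 := hX.col_eq h1
    have h4 := hv.col_eq h2
    omega
  · intro c hc
    obtain ⟨d, h1, h2⟩ := hmem c hc
    rw [key_eq_of_row_eq h]
    exact (hX.key_le h1).trans (hv.key_le h2)

lemma isLeading_pow_mulVec (hX : IsAdapted X) (k : ℕ) {a b : Fin lam.card}
    (h : row lam a = row lam b) (h' : col lam b = col lam a + k) {v : Fin lam.card → F}
    (hv : IsLeading b v) : IsLeading a ((X ^ k).mulVec v) := by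
  induction k generalizing a with
  | zero =>
    obtain rfl := index_ext h h'.symm
    simpa using hv
  | succ k ih =>
    have h1 := start_le_col a
    have h2 := col_lt b
    rw [← h] at h2
    obtain ⟨c, hc, hc'⟩ := exists_index (lam := lam) (r := row lam a) (k := col lam a + 1)
      (by omega) (by omega)
    rw [pow_succ', ← Matrix.mulVec_mulVec]
    exact hX.isLeading_mulVec hc.symm hc' (ih (hc.trans h) (by omega))

lemma pow_ne_zero_imp (hX : IsAdapted X) (k : ℕ) {a b : Fin lam.card} (h : (X ^ k) a b ≠ 0) :
    col lam b = col lam a + k ∧ key lam a ≤ key lam b := by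
  induction k generalizing a with
  | zero =>
    obtain rfl : a = b := by
      by_contra hab
      exact h (by simp [hab])
    simp
  | succ k ih =>
    rw [pow_succ', Matrix.mul_apply] at h
    obtain ⟨d, -, hd⟩ := exists_ne_zero_of_sum_ne_zero h
    obtain ⟨h1, h2⟩ := ih (right_ne_zero_of_mul hd)
    have h3 := hX.col_eq (left_ne_zero_of_mul hd)
    exact ⟨by omega, (hX.key_le (left_ne_zero_of_mul hd)).trans h2⟩

lemma isLeading_single (a : Fin lam.card) : IsLeading a (Pi.single a 1 : Fin lam.card → F) := by
  have : ∀ {c}, (Pi.single a 1 : Fin lam.card → F) c ≠ 0 → c = a := by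
    intro c hc
    by_contra hca
    exact hc (Pi.single_eq_of_ne hca _)
  exact ⟨by simp, fun hc => by rw [this hc], fun hc => by rw [this hc]⟩

lemma key_add_nonneg (a : Fin lam.card) : 0 ≤ key lam a + lam.colLen 0 := by
  have := row_lt a
  simp only [key, rowKey]
  split_ifs <;> omega

/-- The elimination step for triangular systems: all coordinates of `w` other than `a` have smaller
keys and can be subtracted. -/
lemma single_mem_of_isLeading {R : Submodule F (Fin lam.card → F)} {a : Fin lam.card}
    {w : Fin lam.card → F} (hw : IsLeading a w) (hwR : w ∈ R)
    (h : ∀ c, col lam c = col lam a → key lam c < key lam a →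
      (Pi.single c 1 : Fin lam.card → F) ∈ R) :
    (Pi.single a 1 : Fin lam.card → F) ∈ R := by
  have hsub : w - w a • (Pi.single a 1 : Fin lam.card → F) ∈ R := by
    nth_rewrite 1 [pi_eq_sum_univ' w]
    rw [← add_sum_erase univ _ (mem_univ a), add_sub_cancel_left]
    refine Submodule.sum_mem _ fun c hc => ?_
    by_cases hwc : w c = 0
    · simp [hwc]
    refine Submodule.smul_mem _ _ (h c (hw.col_eq hwc) (lt_of_le_of_ne (hw.key_le hwc) ?_))
    exact fun h => ne_of_mem_erase hc (eq_of_key_eq h (hw.col_eq hwc))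
  have := R.smul_mem (w a)⁻¹ (R.sub_mem hwR hsub)
  rwa [sub_sub_cancel, smul_smul, inv_mul_cancel₀ hw.ne_zero, one_smul] at this

/-- A vector whose leading coordinate is at the end of a row can be corrected so as to be killed
by the power of `X` that is given by the length of the row. -/
lemma exists_isLeading_pow_mulVec_eq_zero (hX : IsAdapted X) (z : Fin lam.card)
    (hz : col lam z + 1 = start lam (row lam z) + lam.rowLen (row lam z)) :
    ∃ v : Fin lam.card → F, IsLeading z v ∧ (X ^ lam.rowLen (row lam z)).mulVec v = 0 := by
  set l := lam.rowLen (row lam z) with hl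
  let S : Set (Fin lam.card) := {a | col lam a = col lam z ∧ key lam a < key lam z}
  let R : Submodule F (Fin lam.card → F) :=
    (Submodule.span F (Pi.basisFun F _ '' S)).map (X ^ l).mulVecLin
  -- A row meeting the column just before the start of the row of `z` is longer, hence also meets
  -- the column of `z`, at some `a'`. Applying `X ^ l` to the unit vector at `a'` gives a vector
  -- with leading coordinate `a`; induct on the key.
  have hR : ∀ a, col lam a + l = col lam z → key lam a < key lam z →
      (Pi.single a 1 : Fin lam.card → F) ∈ R := by
    intro a
    induction hk : (key lam a + lam.colLen 0).toNat using Nat.strong_induction_on generalizing a with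
    | _ k ih =>
      intro ha ha'
      have h1 : lam.rowLen (row lam z) ≤ lam.rowLen (row lam a) := by
        by_contra hlt
        have := start_le_start (lam := lam) (not_le.1 hlt).le
        have := start_le_col a
        omega
      have h2 := start_add_rowLen_mono h1
      have h3 := start_le_col a
      obtain ⟨a', hr, hc⟩ := exists_index (lam := lam) (r := row lam a) (k := col lam z)
        (by omega) (by omega)
      have hlead := hX.isLeading_pow_mulVec l hr.symm (by omega)
        (isLeading_single (F := F) a')
      set w := (X ^ l).mulVec (Pi.single a' 1) with hw
      have hwR : w ∈ R := by
        refine Submodule.mem_map_of_mem (Submodule.subset_span ⟨a', ⟨hc, ?_⟩, by simp⟩)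
        rwa [key_eq_of_row_eq hr]
      refine single_mem_of_isLeading hlead hwR fun c hc hca => ih _ ?_ c rfl ?_ ?_
      · have := key_add_nonneg c
        omega
      · rw [hc, ha]
      · exact hca.trans ha'
  -- The image has no coordinate in the row of `z` itself, because its column lies left of the start
  -- of that row; so all keys occurring are strictly smaller.
  have hz' : (X ^ l).mulVec (Pi.single z 1) ∈ R := by
    rw [pi_eq_sum_univ' ((X ^ l).mulVec (Pi.single z 1))]
    refine Submodule.sum_mem _ fun c _ => ?_
    rw [Matrix.mulVec_single_one]
    by_cases hwc : (X ^ l) c z = 0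
    · simp [hwc]
    obtain ⟨h1, h2⟩ := hX.pow_ne_zero_imp l hwc
    refine Submodule.smul_mem _ _ (hR c h1.symm (lt_of_le_of_ne h2 fun h => ?_))
    have := start_le_col c
    rw [row_eq_of_key_eq h] at this
    omega
  obtain ⟨v', hv', hv''⟩ := hz'
  replace hv' := (Basis.mem_span_image _).1 hv'
  have hS : ∀ {c}, v' c ≠ 0 → c ∈ S := fun {c} hc => hv' (by simpa using hc)
  have hcoord : ∀ {c}, (Pi.single z 1 - v' : Fin lam.card → F) c ≠ 0 → c = z ∨ c ∈ S := by
    intro c hc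
    by_contra! hcz
    have : v' c = 0 := by
      by_contra h
      exact hcz.2 (hS h)
    exact hc (by simp [Pi.single_eq_of_ne hcz.1, this])
  refine ⟨Pi.single z 1 - v', ⟨?_, ?_, ?_⟩, ?_⟩
  · have : v' z = 0 := by
      by_contra h
      exact lt_irrefl _ (hS h).2
    simp [this]
  · intro c hc
    rcases hcoord hc with rfl | h
    exacts [rfl, h.1]
  · intro c hc
    rcases hcoord hc with rfl | h
    exacts [le_rfl, h.2.le]
  · rw [Matrix.mulVec_sub, sub_eq_zero]
    exact hv''.symm

lemma top_le_span_of_isLeading {w : Fin lam.card → Fin lam.card → F}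
    (hw : ∀ a, IsLeading a (w a)) : ⊤ ≤ Submodule.span F (Set.range w) := by
  have hsingle : ∀ a, (Pi.single a 1 : Fin lam.card → F) ∈ Submodule.span F (Set.range w) := by
    intro a
    induction hk : (key lam a + lam.colLen 0).toNat using Nat.strong_induction_on generalizing a with
    | _ k ih =>
      refine single_mem_of_isLeading (hw a) (Submodule.subset_span ⟨a, rfl⟩)
        fun c hc hca => ih _ ?_ c rfl
      have := key_add_nonneg c
      omega
  intro v _
  rw [pi_eq_sum_univ' v]
  exact Submodule.sum_mem _ fun c _ => Submodule.smul_mem _ _ (hsingle c)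

/-- Each row yields the Jordan chain of a corrected vector at its last box. The leading coordinates
of all chain members run once through all indices, so the chains span. -/
theorem exists_isJordanBasis (hX : IsAdapted X) :
    ∃ b : Basis {c : ℕ × ℕ // c ∈ lam} F (Fin lam.card → F), IsJordanBasis X.mulVecLin b := by
  have hv : ∀ r, ∃ v : Fin lam.card → F, ∀ z, row lam z = r →
      col lam z + 1 = start lam r + lam.rowLen r →
        IsLeading z v ∧ (X ^ lam.rowLen r).mulVec v = 0 := by
    intro r
    by_cases h : ∃ z, row lam z = r ∧ col lam z + 1 = start lam r + lam.rowLen r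
    · obtain ⟨z, rfl, hz⟩ := h
      obtain ⟨v, hv⟩ := hX.exists_isLeading_pow_mulVec_eq_zero z hz
      refine ⟨v, fun z' h1 h2 => ?_⟩
      obtain rfl := index_ext h1 (by omega)
      exact hv
    · exact ⟨0, fun z h1 h2 => absurd ⟨z, h1, h2⟩ h⟩
  choose v hv using hv
  have hend : ∀ c : {c : ℕ × ℕ // c ∈ lam}, ∃ z, row lam z = c.1.1 ∧
      col lam z + 1 = start lam c.1.1 + lam.rowLen c.1.1 := by
    intro c
    have : c.1.2 < lam.rowLen c.1.1 := YoungDiagram.mem_iff_lt_rowLen.1 c.2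
    obtain ⟨z, h1, h2⟩ := exists_index (lam := lam) (r := c.1.1)
      (k := start lam c.1.1 + lam.rowLen c.1.1 - 1) (by omega) (by omega)
    exact ⟨z, h1, by omega⟩
  let w : {c : ℕ × ℕ // c ∈ lam} → Fin lam.card → F := fun c =>
    (X ^ (lam.rowLen c.1.1 - 1 - c.1.2)).mulVec (v c.1.1)
  have hw : ∀ c, IsLeading (entryEquiv lam c) (w c) := by
    intro c
    obtain ⟨z, h1, h2⟩ := hend c
    have : c.1.2 < lam.rowLen c.1.1 := YoungDiagram.mem_iff_lt_rowLen.1 c.2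
    refine hX.isLeading_pow_mulVec _ (by rw [row_entryEquiv, h1]) ?_ (hv _ z h1 h2).1
    rw [col_entryEquiv]
    omega
  have hspan : ⊤ ≤ Submodule.span F (Set.range w) := by
    have := top_le_span_of_isLeading (w := fun a => w ((entryEquiv lam).symm a)) fun a => by
      simpa using hw ((entryEquiv lam).symm a)
    rwa [← Function.comp_def w, (entryEquiv lam).symm.surjective.range_comp] at this
  have hcard : Fintype.card {c : ℕ × ℕ // c ∈ lam} = finrank F (Fin lam.card → F) := by
    rw [finrank_fin_fun, Fintype.card_congr (entryEquiv lam), Fintype.card_fin]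
  refine ⟨basisOfTopLeSpanOfCardEqFinrank w hspan hcard, ?_, ?_⟩
  · intro i hi
    rw [coe_basisOfTopLeSpanOfCardEqFinrank]
    obtain ⟨z, h1, h2⟩ := hend ⟨(i, 0), hi⟩
    have := YoungDiagram.mem_iff_lt_rowLen.1 hi
    change X.mulVec ((X ^ (lam.rowLen i - 1)).mulVec (v i)) = 0
    rw [Matrix.mulVec_mulVec, ← pow_succ', Nat.sub_add_cancel (by omega)]
    exact (hv _ z h1 h2).2
  · intro i j hij
    rw [coe_basisOfTopLeSpanOfCardEqFinrank]
    have := YoungDiagram.mem_iff_lt_rowLen.1 hij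
    change X.mulVec ((X ^ (lam.rowLen i - 1 - (j + 1))).mulVec (v i)) =
      (X ^ (lam.rowLen i - 1 - j)).mulVec (v i)
    rw [Matrix.mulVec_mulVec, ← pow_succ']
    congr 2
    omega

end IsAdapted

end GGG

namespace GGG

open Finset Module

/-! ### Conjugates of the transposed standard nilpotent matrix -/

lemma exists_ne_of_mulVec_ne_zero {F α : Type*} [Field F] [Fintype α] {M : Matrix α α F}
    {v : α → F} {a : α} (h : M.mulVec v a ≠ 0) : ∃ b, M a b ≠ 0 ∧ v b ≠ 0 := by
  obtain ⟨b, -, hb⟩ := exists_ne_zero_of_sum_ne_zero (s := univ) (f := fun b => M a b * v b) h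
  exact ⟨b, left_ne_zero_of_mul hb, right_ne_zero_of_mul hb⟩

lemma exists_ne_of_mul_ne_zero {F α : Type*} [Field F] [Fintype α] {M N : Matrix α α F}
    {a c : α} (h : (M * N) a c ≠ 0) : ∃ b, M a b ≠ 0 ∧ N b c ≠ 0 := by
  rw [Matrix.mul_apply] at h
  obtain ⟨b, -, hb⟩ := exists_ne_zero_of_sum_ne_zero h
  exact ⟨b, left_ne_zero_of_mul hb, right_ne_zero_of_mul hb⟩

/-- A conjugate `Z` of `W` by a block triangular matrix, with `W` injective from the block of `a`
to the block of `b`, which is triangular in that block has a nonzero diagonal entry there. -/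
theorem apply_ne_zero_of_triangular {F α : Type*} [Field F] [Fintype α] [DecidableEq α]
    {col key : α → ℤ} (hinj : ∀ a b, key a = key b → col a = col b → a = b) {j : ℤ}
    {Z W g g' : Matrix α α F} (hgg : g' * g = 1) (hgZ : g * Z = W * g)
    (hg : ∀ a b, g a b ≠ 0 → col a ≤ col b) (hg' : ∀ a b, g' a b ≠ 0 → col a ≤ col b)
    (hZ : ∀ d c, Z d c ≠ 0 → col d ≤ col c + j)
    (hZ' : ∀ d c, Z d c ≠ 0 → col d = col c + j → key d ≤ key c)
    {a b : α} (hkey : key a = key b) (hcol : col b = col a + j)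
    (hext : ∀ d, col d = col b → key d < key b → ∃ c, col c = col a ∧ key c = key d)
    (hW : ∀ c, col c = col a → ∃ d, col d = col b ∧ ∀ c', W d c' ≠ 0 ↔ c' = c) :
    Z b a ≠ 0 := by
  intro hab
  have htri : ∀ {M : Matrix α α F}, (∀ a b, M a b ≠ 0 → col a ≤ col b) → ∀ {v : α → F} {k : ℤ},
      (∀ c, k ≤ col c → v c = 0) → ∀ c, k ≤ col c → M.mulVec v c = 0 := by
    intro M hM v k hv c hc
    by_contra hne
    obtain ⟨d, h1, h2⟩ := exists_ne_of_mulVec_ne_zero hne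
    exact h2 (hv d (hc.trans (hM c d h1)))
  let S : Finset α := {c | col c = col a ∧ key c ≤ key a}
  let T : Finset α := {d | col d = col b ∧ key d < key b}
  -- By `hext`, `T` injects into `S` by matching keys, and it misses `a`.
  have hcard : #T < #S := by
    have haS : a ∈ S := by simp [S]
    refine lt_of_le_of_lt ?_ (card_erase_lt_of_mem haS)
    choose! f hf using hext
    refine card_le_card_of_injOn f ?_ ?_
    · intro d hd
      obtain ⟨h1, h2⟩ := (mem_filter.1 hd).2
      obtain ⟨h3, h4⟩ := hf d h1 h2
      refine mem_coe.2 (mem_erase.2 ⟨?_, mem_filter.2 ⟨mem_univ _, h3, by omega⟩⟩)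
      intro h
      rw [h] at h4
      omega
    · intro d hd d' hd' hdd
      obtain ⟨h1, h2⟩ := (mem_filter.1 hd).2
      obtain ⟨h3, h4⟩ := (mem_filter.1 hd').2
      refine hinj _ _ ?_ (h1.trans h3.symm)
      rw [← (hf d h1 h2).2, ← (hf d' h3 h4).2, hdd]
  -- Fewer equations than unknowns: a nonzero vector supported on `S` whose image under `Z` vanishes
  -- on `T`.
  obtain ⟨x, hx, hx0⟩ := (Submodule.ne_bot_iff _).1 (LinearMap.ker_ne_bot_of_finrank_lt
    (f := (Z.submatrix (Subtype.val : T → α) (Subtype.val : S → α)).mulVecLin)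
    (by simpa using hcard))
  let v : α → F := fun c => if h : c ∈ S then x ⟨c, h⟩ else 0
  have hvS : ∀ {c}, v c ≠ 0 → c ∈ S := by
    intro c hc
    by_contra h
    exact hc (dif_neg h)
  have hv : ∀ c, col a + 1 ≤ col c → v c = 0 := by
    intro c hc
    by_contra h
    have := (mem_filter.1 (hvS h)).2.1
    omega
  -- In the block of `b`, triangularity handles keys above that of `b`, the choice of `x` handles
  -- those below, and at `b` only the entry `Z b a`, assumed zero, could contribute.
  have hZv : ∀ d, col b ≤ col d → Z.mulVec v d = 0 := by
    intro d hd
    by_contra hne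
    have hmem : ∀ c, Z d c ≠ 0 → v c ≠ 0 → col d = col b ∧ key d ≤ key c ∧ key c ≤ key a ∧
        col c = col a := by
      intro c h1 h2
      obtain ⟨h3, h4⟩ := (mem_filter.1 (hvS h2)).2
      have h5 := hZ d c h1
      exact ⟨by omega, hZ' d c h1 (by omega), h4, h3⟩
    obtain ⟨c, h1, h2⟩ := exists_ne_of_mulVec_ne_zero hne
    obtain ⟨h3, h4, h5, h6⟩ := hmem c h1 h2
    rcases (h4.trans h5).eq_or_lt with h7 | h7
    · obtain rfl := hinj d b (h7.trans hkey) h3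
      obtain rfl := hinj c a (by omega) h6
      exact h1 hab
    · refine hne ?_
      have hdT : d ∈ T := mem_filter.2 ⟨mem_univ _, h3, by omega⟩
      have := congrFun (LinearMap.mem_ker.1 hx) ⟨d, hdT⟩
      change ∑ c : S, Z d c * x c = 0 at this
      change ∑ c, Z d c * v c = 0
      rw [← this, ← sum_subset (subset_univ S), ← sum_coe_sort]
      · refine sum_congr rfl fun c _ => ?_
        simp only [v, dif_pos c.2]
      · intro c _ hc
        simp only [v, dif_neg hc, mul_zero]
  have h1 := htri hg hv
  have h2 := htri hg hZv
  rw [Matrix.mulVec_mulVec, hgZ, ← Matrix.mulVec_mulVec] at h2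
  -- Transport by `g` and injectivity of `W` between the blocks remove the leading block of `g v`;
  -- applying `g'` then removes that of `v`.
  have h3 : ∀ c, col a ≤ col c → g.mulVec v c = 0 := by
    intro c hc
    rcases hc.eq_or_lt with hc | hc
    · obtain ⟨d, hd, hd'⟩ := hW c hc.symm
      have h4 : ∑ c', W d c' * g.mulVec v c' = 0 := h2 d hd.ge
      rw [Fintype.sum_eq_single c] at h4
      · exact (mul_eq_zero.1 h4).resolve_left ((hd' c).2 rfl)
      · intro c' hc'
        rw [not_not.1 (mt (hd' c').1 hc'), zero_mul]
    · exact h1 c hc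
  have h4 := htri hg' h3
  rw [Matrix.mulVec_mulVec, hgg, Matrix.one_mulVec] at h4
  refine hx0 (funext fun c => ?_)
  have h5 := h4 c.1 (mem_filter.1 c.2).2.1.ge
  simp only [v, dif_pos c.2] at h5
  exact h5

variable {lam : YoungDiagram} {F : Type*} [Field F]

/-- The transpose of the standard nilpotent matrix, whose entries `1` are at the transposed arcs
of `ggg lam`. -/
noncomputable def arcMatrix (F : Type*) [Field F] (lam : YoungDiagram) :
    Matrix (Fin lam.card) (Fin lam.card) F :=
  Matrix.of fun b a => if (a, b) ∈ ggg lam then 1 else 0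

lemma arcMatrix_ne_zero {b a : Fin lam.card} :
    arcMatrix F lam b a ≠ 0 ↔ row lam a = row lam b ∧ col lam b = col lam a + 1 := by
  simp [arcMatrix, mem_ggg_iff]

lemma arcMatrix_pow_ne_zero (k : ℕ) {b a : Fin lam.card} :
    (arcMatrix F lam ^ k) b a ≠ 0 ↔ row lam a = row lam b ∧ col lam b = col lam a + k := by
  induction k generalizing b with
  | zero =>
    rw [pow_zero, Matrix.one_apply]
    simp only [ne_eq, ite_eq_right_iff, one_ne_zero, imp_false, not_not, add_zero]
    exact ⟨fun h => by simp [h], fun h => index_ext h.1.symm h.2⟩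
  | succ k ih =>
    constructor
    · intro h
      rw [pow_succ'] at h
      obtain ⟨d, h1, h2⟩ := exists_ne_of_mul_ne_zero h
      obtain ⟨h3, h4⟩ := arcMatrix_ne_zero.1 h1
      obtain ⟨h5, h6⟩ := ih.1 h2
      exact ⟨h5.trans h3, by omega⟩
    · rintro ⟨h1, h2⟩
      have h3 := start_le_col a
      have h4 := col_lt b
      rw [← h1] at h4
      obtain ⟨d, h5, h6⟩ := exists_index (lam := lam) (r := row lam a) (k := col lam a + k)
        (by omega) (by omega)
      rw [pow_succ', Matrix.mul_apply, Fintype.sum_eq_single d]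
      · exact mul_ne_zero (arcMatrix_ne_zero.2 ⟨h5.trans h1, by omega⟩) (ih.2 ⟨h5.symm, h6⟩)
      · intro e he
        by_contra hne
        obtain ⟨h7, h8⟩ := ih.1 (right_ne_zero_of_mul hne)
        exact he (index_ext (h7.symm.trans h5.symm) (by omega))

/-- Let a conjugate of the transposed standard nilpotent matrix by a block triangular matrix be
triangular in degree one for the order on the rows. Then its entries at the transposed arcs of
`ggg lam` are nonzero. -/
theorem conj_arcMatrix_ne_zero {g g' : Matrix (Fin lam.card) (Fin lam.card) F}
    (hgg : g' * g = 1) (hg : ∀ a b, g a b ≠ 0 → col lam a ≤ col lam b)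
    (hg' : ∀ a b, g' a b ≠ 0 → col lam a ≤ col lam b)
    (hlow : ∀ a b, col lam b = col lam a + 1 → key lam a < key lam b →
      (g' * arcMatrix F lam * g) b a = 0)
    {a b : Fin lam.card} (hrow : row lam a = row lam b) (hcol : col lam b = col lam a + 1) :
    (g' * arcMatrix F lam * g) b a ≠ 0 := by
  set Y := arcMatrix F lam
  set Z := g' * Y * g with hZ
  intro hab
  have hgg' : g * g' = 1 := mul_eq_one_comm.1 hgg
  have hpow : ∀ k, Z ^ k = g' * Y ^ k * g := by
    intro k
    induction k with
    | zero => simp [hgg]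
    | succ k ih =>
      rw [pow_succ, ih, hZ, pow_succ]
      simp only [mul_assoc]
      rw [← mul_assoc g g', hgg', one_mul]
  have hcolZ : ∀ k d c, (Z ^ k) d c ≠ 0 → col lam d ≤ col lam c + k := by
    intro k d c h
    rw [hpow] at h
    obtain ⟨e, h1, h2⟩ := exists_ne_of_mul_ne_zero h
    obtain ⟨f, h3, h4⟩ := exists_ne_of_mul_ne_zero h1
    have h5 := hg _ _ h2
    have h6 := hg' _ _ h3
    have h7 := ((arcMatrix_pow_ne_zero k).1 h4).2
    omega
  have hkeyZ : ∀ k d c, (Z ^ k) d c ≠ 0 → col lam d = col lam c + k → key lam d ≤ key lam c := by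
    intro k
    induction k with
    | zero =>
      intro d c h _
      have : d = c := by
        by_contra hne
        exact h (by simp [hne])
      rw [this]
    | succ k ih =>
      intro d c h h'
      rw [pow_succ'] at h
      obtain ⟨e, h1, h2⟩ := exists_ne_of_mul_ne_zero h
      have h3 := hcolZ _ _ _ h2
      have h4 := hcolZ 1 d e (by rwa [pow_one])
      refine le_trans ?_ (ih e c h2 (by omega))
      by_contra! hlt
      exact h1 (hlow e d (by omega) hlt)
  have hsa := start_le_col a
  have hbz := col_lt b
  rw [← hrow] at hbz
  obtain ⟨j, hj⟩ : ∃ j, lam.rowLen (row lam a) = j + 1 :=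
    ⟨lam.rowLen (row lam a) - 1, by omega⟩
  obtain ⟨z, hzr, hzc⟩ := exists_index (lam := lam) (r := row lam a)
    (k := start lam (row lam a) + j) (by omega) (by omega)
  obtain ⟨s, hsr, hsc⟩ := exists_index (lam := lam) (r := row lam a)
    (k := start lam (row lam a)) le_rfl (by omega)
  have hzs : col lam z = col lam s + j := by omega
  have hkey : key lam s = key lam z := key_eq_of_row_eq (hsr.trans hzr.symm)
  -- The entry from the first to the last box of the row is considered, since there a power of the
  -- arc matrix is injective or surjective between columns. By triangularity every contributing path
  -- passes through the arc from `a` to `b`, so a vanishing arc entry makes it vanish.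
  have hzero : (Z ^ j) z s = 0 := by
    by_contra hne
    rw [show j = (col lam z - col lam b) + (1 + (col lam a - col lam s)) by omega, pow_add,
      pow_add, pow_one] at hne
    obtain ⟨d, h1, h2⟩ := exists_ne_of_mul_ne_zero hne
    obtain ⟨e, h3, h4⟩ := exists_ne_of_mul_ne_zero h2
    have h5 := hcolZ _ _ _ h1
    have h6 := hcolZ 1 d e (by rwa [pow_one])
    have h7 := hcolZ _ _ _ h4
    have h8 := hkeyZ _ _ _ h1 (by omega)
    have h9 := hkeyZ 1 d e (by rwa [pow_one]) (by omega)
    have h10 := hkeyZ _ _ _ h4 (by omega)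
    have h11 : key lam a = key lam z := key_eq_of_row_eq hzr.symm
    have h12 : key lam a = key lam b := key_eq_of_row_eq hrow
    obtain rfl : d = b := eq_of_key_eq (by omega) (by omega)
    obtain rfl : e = a := eq_of_key_eq (by omega) (by omega)
    exact h3 hab
  -- For even length, each row meeting the first column of this row is at least as long, so `Y ^ j`
  -- is injective from the first column to the last.
  by_cases heven : Even (lam.rowLen (row lam a))
  · refine apply_ne_zero_of_triangular (col := fun a => (col lam a : ℤ)) (key := key lam)
      (j := j) (W := Y ^ j) (g := g) (g' := g') (a := s) (b := z)
      (fun a b h h' => eq_of_key_eq h (by omega)) hgg ?_ (fun a b h => by exact_mod_cast hg a b h)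
      (fun a b h => by exact_mod_cast hg' a b h) (fun d c h => by exact_mod_cast hcolZ j d c h)
      (fun d c h h' => hkeyZ j d c h (by exact_mod_cast h')) hkey (by exact_mod_cast hzs)
      ?_ ?_ hzero
    · rw [hpow, ← mul_assoc, ← mul_assoc, hgg', one_mul]
    · intro d hd hdz
      have h1 := rowLen_le_of_key_le (by rwa [hzr]) hdz.le
      rw [hzr] at h1
      have h2 := start_le_start h1
      have h3 := start_le_col d
      have h4 := col_lt d
      obtain ⟨c, h5, h6⟩ := exists_index (lam := lam) (r := row lam d) (k := col lam s)
        (by omega) (by omega)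
      exact ⟨c, by omega, key_eq_of_row_eq h5⟩
    · intro c hc
      have h1 := start_le_col c
      have h2 : lam.rowLen (row lam a) ≤ lam.rowLen (row lam c) := by
        obtain ⟨t, ht⟩ := heven
        have := lam.rowLen_anti 0 (row lam a) (Nat.zero_le _)
        simp only [start] at h1 hsc
        omega
      have h3 := start_add_rowLen_mono h2
      obtain ⟨d, h5, h6⟩ := exists_index (lam := lam) (r := row lam c) (k := col lam z)
        (by omega) (by omega)
      refine ⟨d, by omega, fun c' => ?_⟩
      rw [arcMatrix_pow_ne_zero]
      exact ⟨fun h => index_ext (h.1.trans h5) (by omega), by rintro rfl; exact ⟨h5.symm, by omega⟩⟩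
  -- For odd length it is the last column that only meets rows at least as long, so the transposed
  -- power is injective. Transposition reverses columns and keys, hence the signs.
  · refine apply_ne_zero_of_triangular (col := fun a => -(col lam a : ℤ))
      (key := fun a => -key lam a)
      (j := j) (W := (Y ^ j).transpose) (Z := (Z ^ j).transpose) (g := g'.transpose)
      (g' := g.transpose) (a := z) (b := s)
      (fun a b h h' => eq_of_key_eq (by omega) (by omega)) ?_ ?_ (fun a b h => ?_)
      (fun a b h => ?_) (fun d c h => ?_) (fun d c h h' => ?_) ?_ ?_ ?_ ?_ hzero
    · rw [← Matrix.transpose_mul, hgg, Matrix.transpose_one]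
    · rw [← Matrix.transpose_mul, ← Matrix.transpose_mul, hpow, mul_assoc, hgg', mul_one]
    · have := hg' b a h
      omega
    · have := hg b a h
      omega
    · have := hcolZ j c d h
      omega
    · have := hkeyZ j c d h (by omega)
      omega
    · omega
    · omega
    · intro c hc hcs
      have h1 := rowLen_le_of_le_key (a := c) (b := s) (by rwa [hsr]) (by omega)
      rw [hsr] at h1
      have h2 := start_add_rowLen_mono h1
      have h3 := start_le_col c
      obtain ⟨d, h5, h6⟩ := exists_index (lam := lam) (r := row lam c) (k := col lam z)
        (by omega) (by omega)
      exact ⟨d, by omega, by rw [key_eq_of_row_eq h5]⟩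
    · intro d hd
      have h1 := col_lt d
      have h2 : lam.rowLen (row lam a) ≤ lam.rowLen (row lam d) := by
        rw [Nat.not_even_iff_odd] at heven
        obtain ⟨t, ht⟩ := heven
        have := lam.rowLen_anti 0 (row lam a) (Nat.zero_le _)
        have := lam.rowLen_anti 0 (row lam d) (Nat.zero_le _)
        simp only [start] at h1 hsc
        omega
      have h3 := start_le_start h2
      obtain ⟨c, h5, h6⟩ := exists_index (lam := lam) (r := row lam d) (k := col lam s)
        (by omega) (by omega)
      refine ⟨c, by omega, fun d' => ?_⟩
      rw [Matrix.transpose_apply, arcMatrix_pow_ne_zero]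
      exact ⟨fun h => index_ext (h.1.symm.trans h5) (by omega),
        by rintro rfl; exact ⟨h5, by omega⟩⟩

end GGG

namespace GGG

open Finset Module

variable {lam : YoungDiagram} {F : Type*} [Field F]

/-! ### Conjugacy -/

lemma finrank_stdFlag (k : ℕ) : finrank F (stdFlag F lam k) = #{a | col lam a < k} :=
  finrank_coordFlag _ _ _

/-- The pullback of the standard flag by `g` is lowered by `N`, so uniqueness identifies it with a
flag that does not depend on `g`. -/
lemma stdFlag_eq_coordFlag {N : Matrix (Fin lam.card) (Fin lam.card) F}
    {b : Basis {c : ℕ × ℕ // c ∈ lam} F (Fin lam.card → F)} (hb : IsJordanBasis N.mulVecLin b)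
    (g : GL (Fin lam.card) F) (hN : ∀ a b, (g.val * N * g⁻¹.val) a b ≠ 0 → col lam a < col lam b)
    (k : ℕ) :
    (stdFlag F lam k).comap g.val.mulVecLin = coordFlag b (fun c => shiftedColumn lam c) k := by
  have hgg : g⁻¹.val * g.val = 1 := Units.inv_mul g
  have hgg' : g.val * g⁻¹.val = 1 := Units.mul_inv g
  refine flag_eq_coordFlag hb (fun k => (stdFlag F lam k).comap g.val.mulVecLin)
    (fun i j hij => Submodule.comap_mono (coordFlag_mono _ _ hij)) ?_ ?_ k
  · intro k v hv
    have := mulVec_mem_stdFlag hN hv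
    rw [Matrix.mulVecLin_apply, Matrix.mulVec_mulVec, mul_assoc, hgg, mul_one,
      ← Matrix.mulVec_mulVec] at this
    exact this
  · intro k
    let e : (Fin lam.card → F) ≃ₗ[F] (Fin lam.card → F) :=
      LinearEquiv.ofLinearMap g.val.mulVecLin g⁻¹.val.mulVecLin
        (by rw [← Matrix.mulVecLin_mul, hgg', Matrix.mulVecLin_one])
        (by rw [← Matrix.mulVecLin_mul, hgg, Matrix.mulVecLin_one])
    have h1 : (stdFlag F lam k).comap g.val.mulVecLin =
        (stdFlag F lam k).map e.symm.toLinearMap := Submodule.comap_equiv_eq_map_symm e _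
    rw [h1, LinearEquiv.finrank_map_eq, finrank_stdFlag, finrank_coordFlag]
    refine card_bij (fun a _ => (entryEquiv lam).symm a)
      (fun a ha => mem_filter.2 ⟨mem_univ _, (mem_filter.1 ha).2⟩)
      (fun a _ b _ h => (entryEquiv lam).symm.injective h)
      (fun c hc => ⟨entryEquiv lam c, mem_filter.2 ⟨mem_univ _, ?_⟩, by simp⟩)
    simpa [col] using (mem_filter.1 hc).2

/-- The elements that conjugate a Richardson element of `U_{ctr(lam')}` into `U_{ctr(lam')}` are
block upper triangular. -/
lemma col_le_of_conj {N : Matrix (Fin lam.card) (Fin lam.card) F}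
    {b : Basis {c : ℕ × ℕ // c ∈ lam} F (Fin lam.card → F)} (hb : IsJordanBasis N.mulVecLin b)
    (hN : ∀ a b, N a b ≠ 0 → col lam a < col lam b) {g : GL (Fin lam.card) F}
    (hgN : ∀ a b, (g.val * N * g⁻¹.val) a b ≠ 0 → col lam a < col lam b) {a b : Fin lam.card}
    (hab : g.val a b ≠ 0) : col lam a ≤ col lam b := by
  have h1 := stdFlag_eq_coordFlag hb g hgN (col lam b + 1)
  -- Comparing with the identity shows that `g` preserves the standard flag.
  rw [← stdFlag_eq_coordFlag hb 1 (by simpa using hN)] at h1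
  have h2 : (Pi.single b 1 : Fin lam.card → F) ∈
      (stdFlag F lam (col lam b + 1)).comap (1 : GL (Fin lam.card) F).val.mulVecLin := by
    simp only [Units.val_one, Matrix.mulVecLin_one, Submodule.comap_id, mem_stdFlag]
    intro c hc
    refine Pi.single_eq_of_ne ?_ _
    rintro rfl
    omega
  rw [← h1, Submodule.mem_comap, Matrix.mulVecLin_apply, Matrix.mulVec_single_one,
    mem_stdFlag] at h2
  by_contra hlt
  exact hab (h2 a (by omega))

lemma inv_col_le {g : GL (Fin lam.card) F} (hg : ∀ a b, g.val a b ≠ 0 → col lam a ≤ col lam b)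
    (a b : Fin lam.card) (h : g⁻¹.val a b ≠ 0) : col lam a ≤ col lam b := by
  have hbt : Matrix.BlockTriangular g.val (col lam) := fun i j hij =>
    not_not.1 (mt (hg i j) (not_le.2 hij))
  have : Invertible g.val := g.invertible
  have hinv : Matrix.BlockTriangular (g⁻¹).val (col lam) := by
    have := Matrix.blockTriangular_inv_of_blockTriangular hbt
    rwa [← Matrix.coe_units_inv] at this
  exact not_lt.1 fun hlt => h (hinv hlt)

lemma exists_conj_of_isJordanBasis {n : ℕ} {mu : YoungDiagram} {u v : GL (Fin n) F}
    {b c : Basis {c : ℕ × ℕ // c ∈ mu} F (Fin n → F)}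
    (hb : IsJordanBasis (u.val - 1).mulVecLin b) (hc : IsJordanBasis (v.val - 1).mulVecLin c) :
    ∃ g : GL (Fin n) F, g * u * g⁻¹ = v := by
  let e := b.equiv c (Equiv.refl _)
  let g : GL (Fin n) F := ⟨LinearMap.toMatrix' e.toLinearMap, LinearMap.toMatrix' e.symm.toLinearMap,
    by rw [← LinearMap.toMatrix'_comp]; simp, by rw [← LinearMap.toMatrix'_comp]; simp⟩
  have h1 : e.toLinearMap ∘ₗ (u.val - 1).mulVecLin = (v.val - 1).mulVecLin ∘ₗ e.toLinearMap := by
    refine b.ext ?_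
    rintro ⟨⟨i, j⟩, hij⟩
    cases j with
    | zero => simp only [LinearMap.comp_apply, hb.map_zero, LinearEquiv.coe_coe, e,
        Basis.equiv_apply, Equiv.refl_apply, hc.map_zero, map_zero]
    | succ j => simp only [LinearMap.comp_apply, hb.map_succ, LinearEquiv.coe_coe, e,
        Basis.equiv_apply, Equiv.refl_apply, hc.map_succ]
  have h2 := congrArg LinearMap.toMatrix' h1
  rw [LinearMap.toMatrix'_comp, LinearMap.toMatrix'_comp] at h2
  change g.val * LinearMap.toMatrix' (Matrix.toLin' _) =
    LinearMap.toMatrix' (Matrix.toLin' _) * g.val at h2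
  rw [LinearMap.toMatrix'_toLin', LinearMap.toMatrix'_toLin', mul_sub, sub_mul, mul_one,
    one_mul, sub_left_inj] at h2
  refine ⟨g, mul_inv_eq_iff_eq_mul.2 (Units.ext ?_)⟩
  simpa using h2

namespace IsAdapted

variable {X : Matrix (Fin lam.card) (Fin lam.card) F}

lemma col_lt_col (hX : IsAdapted X) {a b : Fin lam.card} (h : X a b ≠ 0) : col lam a < col lam b := by
  have := hX.col_eq h
  omega

lemma isUnit_one_add (hX : IsAdapted X) : IsUnit (1 + X) := by
  refine IsNilpotent.isUnit_one_add ⟨lam.rowLen 0, Matrix.ext fun a b => ?_⟩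
  by_contra h
  have h1 := (hX.pow_ne_zero_imp _ h).1
  have h2 := (col_lt b).trans_le (start_add_rowLen_le _)
  omega

end IsAdapted

/-! ### Evaluation of the character -/

open Classical in
/-- The linear character `γ_lam`, extended by zero. -/
noncomputable def gammaExt (ϑ : AddChar F ℂ) (lam : YoungDiagram) (g : GL (Fin lam.card) F) : ℂ :=
  if h : g ∈ unipotentRadical lam.card F (ctrComposition lam) then gamma ϑ lam ⟨g, h⟩ else 0

lemma map_sum_eq_prod {A M ι : Type*} [AddCommMonoid A] [CommMonoid M] (ψ : AddChar A M)
    (s : Finset ι) (f : ι → A) : ψ (∑ i ∈ s, f i) = ∏ i ∈ s, ψ (f i) :=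
  map_prod ψ.toMonoidHom (fun i => Multiplicative.ofAdd (f i)) s

/-- In trace form, a conjugation of the argument can be moved by cyclicity onto the arc matrix. -/
lemma gammaExt_of_mem (ϑ : AddChar F ℂ) {g : GL (Fin lam.card) F}
    (h : g ∈ unipotentRadical lam.card F (ctrComposition lam)) :
    gammaExt ϑ lam g = ϑ (arcMatrix F lam * (g.val - 1)).trace := by
  rw [gammaExt, dif_pos h]
  change ∏ p ∈ ggg lam, ϑ (g.val p.1 p.2) = _
  have h1 : (arcMatrix F lam * (g.val - 1)).trace =
      ∑ p : Fin lam.card × Fin lam.card, if p ∈ ggg lam then (g.val - 1) p.1 p.2 else 0 := by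
    rw [Fintype.sum_prod_type_right]
    simp only [Matrix.trace, Matrix.diag_apply, Matrix.mul_apply, arcMatrix, Matrix.of_apply,
      ite_mul, one_mul, zero_mul]
  rw [h1, ← sum_filter, filter_mem_eq_inter, univ_inter, map_sum_eq_prod]
  refine prod_congr rfl fun p hp => ?_
  obtain ⟨a, b⟩ := p
  have hne : a ≠ b := by
    rintro rfl
    have := (mem_ggg_iff.1 hp).2
    omega
  simp [Matrix.one_apply_ne hne]

lemma card_mul_gggCharacter [Fintype (GL (Fin lam.card) F)]
    [Fintype (unipotentRadical lam.card F (ctrComposition lam))] (ϑ : AddChar F ℂ)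
    (g : GL (Fin lam.card) F) :
    (Fintype.card (unipotentRadical lam.card F (ctrComposition lam)) : ℂ) * gggCharacter ϑ lam g =
      ∑ h, gammaExt ϑ lam (h * g * h⁻¹) := by
  classical
  simp only [gammaExt]
  rw [gggCharacter, gammaRep]
  convert card_mul_character_ind (unipotentRadical lam.card F (ctrComposition lam)) (gamma ϑ lam) g

lemma HasJordanType.conj {n : ℕ} {mu : YoungDiagram} {u : GL (Fin n) F} (h : HasJordanType u mu)
    (g : GL (Fin n) F) : HasJordanType (g * u * g⁻¹) mu := by
  obtain ⟨b, h0, h1⟩ := h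
  have hgg : g⁻¹.val * g.val = 1 := Units.inv_mul g
  have hgg' : g.val * g⁻¹.val = 1 := Units.mul_inv g
  have key : ∀ v, ((g * u * g⁻¹).val - 1).mulVec (g.val.mulVec v) =
      g.val.mulVec ((u.val - 1).mulVec v) := by
    intro v
    rw [Matrix.mulVec_mulVec, Matrix.mulVec_mulVec, Units.val_mul, Units.val_mul, sub_mul,
      mul_assoc, hgg, mul_one, one_mul, mul_sub, mul_one]
  refine ⟨b.map (LinearEquiv.ofLinearMap g.val.mulVecLin g⁻¹.val.mulVecLin
    (by rw [← Matrix.mulVecLin_mul, hgg', Matrix.mulVecLin_one])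
    (by rw [← Matrix.mulVecLin_mul, hgg, Matrix.mulVecLin_one])), ?_, ?_⟩
  · intro i hi
    refine (key (b ⟨(i, 0), hi⟩)).trans ?_
    rw [h0, Matrix.mulVec_zero]
  · intro i j hij
    refine (key (b ⟨(i, j + 1), hij⟩)).trans ?_
    rw [h1]
    rfl

theorem gggCharacter_eq_zero [Finite F] (ϑ : AddChar F ℂ) {mu : YoungDiagram}
    {u : GL (Fin lam.card) F} (hu : HasJordanType u mu) (h : ¬ DominatedBy mu lam) :
    gggCharacter ϑ lam u = 0 := by
  classical
  have := Fintype.ofFinite (GL (Fin lam.card) F)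
  have key := card_mul_gggCharacter ϑ u
  rw [sum_eq_zero, mul_eq_zero] at key
  · exact key.resolve_left (by simp)
  · intro g _
    exact dif_neg fun hg => h (dominatedBy_of_mem_unipotentRadical hg (hu.conj g))

/-! ### Exponential sums over the adapted matrices -/

section sums

variable [Fintype F]

/-- The sum of a nontrivial additive character over the allowed values of an entry. -/
noncomputable def entrySum (F : Type*) [Field F] [Fintype F]
    (p : Fin lam.card × Fin lam.card) : ℂ :=
  if col lam p.2 = col lam p.1 + 1 then
    if key lam p.1 < key lam p.2 then Fintype.card F else if row lam p.1 = row lam p.2 then -1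
    else 1
  else 1

lemma prod_entrySum_ne_zero :
    ∏ p : Fin lam.card × Fin lam.card, entrySum F p ≠ 0 := by
  refine prod_ne_zero_iff.2 fun p _ => ?_
  simp only [entrySum]
  split_ifs <;> simp

variable [DecidableEq F]

/-- The values allowed for the entries of a matrix of degree one that is triangular for the order
on the rows and is nonzero at the arcs. -/
noncomputable def adaptedEntries (F : Type*) [Field F] [Fintype F] [DecidableEq F]
    (p : Fin lam.card × Fin lam.card) : Finset F :=
  if col lam p.2 = col lam p.1 + 1 then
    if key lam p.1 < key lam p.2 then univ else if row lam p.1 = row lam p.2 then univ.erase 0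
    else {0}
  else {0}

lemma isAdapted_of_mem {f : Fin lam.card × Fin lam.card → F}
    (hf : f ∈ Fintype.piFinset (adaptedEntries (lam := lam) F)) :
    IsAdapted (Matrix.of fun a b => f (a, b)) := by
  have h : ∀ a b, f (a, b) ∈ adaptedEntries F (a, b) := fun a b => Fintype.mem_piFinset.1 hf _
  simp only [adaptedEntries] at h
  refine ⟨fun {a b} hab => ?_, fun {a b} hab => ?_, fun {a b} hr hc => ?_⟩
  · by_contra hc
    have := h a b
    rw [if_neg hc, mem_singleton] at this
    exact hab this
  · by_contra hk
    have := h a b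
    rw [if_neg (fun h : key lam a < key lam b => hk h.le),
      if_neg (fun h => hk (key_eq_of_row_eq h).le), ite_self, mem_singleton] at this
    exact hab this
  · have := h a b
    rw [if_pos hc, if_neg (by simp [key_eq_of_row_eq hr]), if_pos hr] at this
    exact ne_of_mem_erase this

/-- A free entry has `y = 0` and gives |F|; at an arc, the full character sum is 0, so removing `x =
0` leaves -1; any other entry is fixed at 0 and gives 1. -/
lemma sum_adaptedEntries {ϑ : AddChar F ℂ} (hϑ : ϑ ≠ 1) {p : Fin lam.card × Fin lam.card} {y : F}
    (h0 : col lam p.2 = col lam p.1 + 1 → key lam p.1 < key lam p.2 → y = 0)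
    (h1 : col lam p.2 = col lam p.1 + 1 → row lam p.1 = row lam p.2 → y ≠ 0) :
    ∑ x ∈ adaptedEntries F p, ϑ (y * x) = entrySum F p := by
  have hsum := AddChar.sum_mulShift y (AddChar.IsPrimitive.of_ne_one hϑ)
  simp only [mul_comm _ y] at hsum
  simp only [adaptedEntries, entrySum]
  split_ifs with hc hk hr
  · simp [h0 hc hk]
  · rw [sum_erase_eq_sub (mem_univ _), hsum, if_neg (h1 hc hr)]
    simp
  · simp
  · simp

/-- The sum factors over the entries. One nonzero entry of `Z` at a free position makes its factor a
complete nontrivial character sum, hence 0; this is why `hZ` only asserts nonvanishing at the arcs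
conditionally. -/
lemma prod_sum_adaptedEntries {ϑ : AddChar F ℂ} (hϑ : ϑ ≠ 1)
    {Z : Matrix (Fin lam.card) (Fin lam.card) F}
    (hZ : (∀ a b, col lam b = col lam a + 1 → key lam a < key lam b → Z b a = 0) →
      ∀ a b, row lam a = row lam b → col lam b = col lam a + 1 → Z b a ≠ 0) :
    ∑ f ∈ Fintype.piFinset (adaptedEntries (lam := lam) F),
      ϑ (Z * Matrix.of fun a b => f (a, b)).trace =
    if ∀ a b, col lam b = col lam a + 1 → key lam a < key lam b → Z b a = 0 then
      ∏ p : Fin lam.card × Fin lam.card, entrySum F p else 0 := by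
  have h1 : ∀ f : Fin lam.card × Fin lam.card → F, ϑ (Z * Matrix.of fun a b => f (a, b)).trace =
      ∏ p, ϑ (Z p.2 p.1 * f p) := by
    intro f
    rw [← map_sum_eq_prod, Fintype.sum_prod_type_right]
    rfl
  simp only [h1]
  rw [← prod_univ_sum (adaptedEntries F) fun p x => ϑ (Z p.2 p.1 * x)]
  split_ifs with h
  · exact prod_congr rfl fun p _ => sum_adaptedEntries hϑ (h p.1 p.2)
      fun hc hr => hZ h p.1 p.2 hr hc
  · push Not at h
    obtain ⟨a, b, hc, hk, hne⟩ := h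
    refine prod_eq_zero (mem_univ (a, b)) ?_
    have hsum := AddChar.sum_mulShift (Z b a) (AddChar.IsPrimitive.of_ne_one hϑ)
    simp only [adaptedEntries, if_pos hc, if_pos hk, mul_comm (Z b a)]
    rw [hsum, if_neg hne, Nat.cast_zero]

end sums

/-! ### Nonvanishing by averaging over the adapted elements -/

theorem gggCharacter_ne_zero [Finite F] {ϑ : AddChar F ℂ} (hϑ : ϑ ≠ 1) {u : GL (Fin lam.card) F}
    (hu : HasJordanType u lam) : gggCharacter ϑ lam u ≠ 0 := by
  classical
  have := Fintype.ofFinite F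
  have := Fintype.ofFinite (GL (Fin lam.card) F)
  obtain ⟨b, hb⟩ := isJordanBasis_of_hasJordanType hu
  let mat : (Fin lam.card × Fin lam.card → F) → Matrix (Fin lam.card) (Fin lam.card) F :=
    fun f => Matrix.of fun a b => f (a, b)
  let T := Fintype.piFinset (adaptedEntries (lam := lam) F)
  have hv : ∀ f, ∃ v : GL (Fin lam.card) F, f ∈ T → v.val - 1 = mat f := by
    intro f
    by_cases hf : f ∈ T
    · obtain ⟨v, hv⟩ := (isAdapted_of_mem hf).isUnit_one_add
      exact ⟨v, fun _ => by rw [hv, add_sub_cancel_left]⟩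
    · exact ⟨1, fun h => absurd h hf⟩
  choose v hv using hv
  have hconj : ∀ f ∈ T, gggCharacter ϑ lam (v f) = gggCharacter ϑ lam u := by
    intro f hf
    obtain ⟨c, hc⟩ := (isAdapted_of_mem hf).exists_isJordanBasis
    obtain ⟨g, hg⟩ := exists_conj_of_isJordanBasis (v := v f) hb (by rw [hv f hf]; exact hc)
    rw [← hg]
    exact Representation.char_conj _ _ _
  -- The elements `g` with a nonzero contribution.
  let P : Finset (GL (Fin lam.card) F) := {g | (∀ a b, g.val a b ≠ 0 → col lam a ≤ col lam b) ∧
    ∀ a b, col lam b = col lam a + 1 → key lam a < key lam b →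
      (g⁻¹.val * arcMatrix F lam * g.val) b a = 0}
  have hinner : ∀ g, ∑ f ∈ T, gammaExt ϑ lam (g * v f * g⁻¹) =
      if g ∈ P then ∏ p : Fin lam.card × Fin lam.card, entrySum F p else 0 := by
    intro g
    have hgg : g⁻¹.val * g.val = 1 := Units.inv_mul g
    have hgg' : g.val * g⁻¹.val = 1 := Units.mul_inv g
    have hsub : ∀ f ∈ T, (g * v f * g⁻¹).val - 1 = g.val * mat f * g⁻¹.val := by
      intro f hf
      rw [← hv f hf, Units.val_mul, Units.val_mul, mul_sub, sub_mul, mul_one, hgg']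
    by_cases hg : ∀ a b, g.val a b ≠ 0 → col lam a ≤ col lam b
    · have hg' := inv_col_le hg
      have hmem : ∀ f ∈ T, g * v f * g⁻¹ ∈ unipotentRadical lam.card F (ctrComposition lam) := by
        intro f hf
        rw [mem_unipotentRadical_iff, hsub f hf]
        intro a b hab
        obtain ⟨d, h1, h2⟩ := exists_ne_of_mul_ne_zero hab
        obtain ⟨c, h3, h4⟩ := exists_ne_of_mul_ne_zero h1
        have h5 := hg _ _ h3
        have h6 := hg' _ _ h2
        have h7 := (isAdapted_of_mem hf).col_lt_col h4
        omega
      have h1 : ∀ f ∈ T, gammaExt ϑ lam (g * v f * g⁻¹) =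
          ϑ ((g⁻¹.val * arcMatrix F lam * g.val) * mat f).trace := by
        intro f hf
        rw [gammaExt_of_mem ϑ (hmem f hf), hsub f hf, ← mul_assoc, Matrix.trace_mul_comm]
        simp only [mul_assoc]
      rw [sum_congr rfl h1, prod_sum_adaptedEntries hϑ
        fun hlow a b hr hc => conj_arcMatrix_ne_zero hgg hg hg' hlow hr hc]
      refine if_congr ?_ rfl rfl
      simp only [P, mem_filter, mem_univ, true_and]
      exact ⟨fun h => ⟨hg, h⟩, fun h => h.2⟩
    · rw [if_neg fun h => hg (mem_filter.1 h).2.1]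
      -- For `g` not block triangular, no adapted element is conjugated into the unipotent group.
      refine sum_eq_zero fun f hf => dif_neg fun hmem => hg fun a b hab => ?_
      rw [mem_unipotentRadical_iff, hsub f hf] at hmem
      obtain ⟨c, hc⟩ := (isAdapted_of_mem hf).exists_isJordanBasis
      exact col_le_of_conj hc (fun a b h => (isAdapted_of_mem hf).col_lt_col h) hmem hab
  intro hzero
  have htotal : ∑ f ∈ T, (Fintype.card (unipotentRadical lam.card F (ctrComposition lam)) : ℂ) *
      gggCharacter ϑ lam (v f) = 0 :=
    sum_eq_zero fun f hf => by rw [hconj f hf, hzero, mul_zero]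
  simp only [card_mul_gggCharacter] at htotal
  rw [sum_comm] at htotal
  simp only [hinner] at htotal
  rw [← sum_filter, sum_const, nsmul_eq_mul, mul_eq_zero] at htotal
  refine htotal.elim (fun h => ?_) prod_entrySum_ne_zero
  rw [Nat.cast_eq_zero, card_eq_zero] at h
  -- The identity lies in `P`: arcs join boxes of one row, so the arc matrix vanishes at all free
  -- positions.
  refine notMem_empty (1 : GL (Fin lam.card) F) (h ▸ ?_)
  simp only [P, mem_filter, mem_univ, true_and, Units.val_one, inv_one, one_mul, mul_one]
  constructor
  · intro a b hab
    by_contra hlt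
    refine hab (Matrix.one_apply_ne ?_)
    rintro rfl
    exact hlt le_rfl
  · intro a b _ hk
    by_contra hne
    exact hk.ne (key_eq_of_row_eq (arcMatrix_ne_zero.1 hne).1)

end GGG

theorem mainTheorem11 {F : Type*} [Field F] [Finite F] (ϑ : AddChar F ℂ) (hϑ : ϑ ≠ 1)
    (lam : YoungDiagram) :
    (∀ mu : YoungDiagram, mu.card = lam.card →
      ∀ u : GL (Fin lam.card) F, GGG.HasJordanType u mu →
        ¬ GGG.DominatedBy mu lam → GGG.gggCharacter ϑ lam u = 0) ∧
    (∀ u : GL (Fin lam.card) F, GGG.HasJordanType u lam → GGG.gggCharacter ϑ lam u ≠ 0) :=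
  ⟨fun _ _ _ hu h => GGG.gggCharacter_eq_zero ϑ hu h, fun _ hu => GGG.gggCharacter_ne_zero hϑ hu⟩
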